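/- **Setting.** Let $E$ be a locally compact Polish space with a smooth manifold structure, let $C_0(E)$ be the continuous real functions on $E$ vanishing at infinity (with the supremum norm) and let $C_c^\infty(E)$ be the compactly supported smooth ones. Let $n\ge 1$ and $\bar E=E^n$; for $f:E\to\mathbb R$ write $f_i(x_1,\dots,x_n)=f(x_i)$. A *Feller semigroup* is the semigroup $S_tf(x)=\int f(y)\,\kappa_t(x,\mathrm dy)$ of a family of Markov transition kernels $(\kappa_t)_{t\ge0}$ ($\kappa_0=$ identity, Chapman–Kolmogorov) that leaves $C_0$ invariant and is strongly continuous on it. Its generator $\mathcal L f=\lim_{t\downarrow 0}(S_tf-f)/t$ is taken in $C_0$ with domain $\mathcal D(\mathcal L)$; its extended generator is the same limit taken for bounded continuous $f$, uniformly on compact sets. The semigroup is *ergodic* with invariant measure $\mu$ if $\mu$ is the unique probability measure with $\int\mathcal Lf\,\mathrm d\mu=0$ for all $f\in\mathcal D(\mathcal L)$, and $\frac1T\int_0^T S_tf(x)\,\mathrm dt\to\int f\,\mathrm d\mu$ as $T\to\infty$ for all bounded continuous $f$ and all starting points $x$ (which follows from almost sure convergence of the pathwise ergodic averages). Let $(S_t)_{t\ge0}$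 be a Feller semigroup on $E$ with generator $\mathcal L$, ergodic with invariant measure $\pi$, such that $C_c^\infty(E)\subset\mathcal D(\mathcal L)$ is a core for $\mathcal L$. Let $\mathcal L_i$ denote $\mathcal L$ acting on the $i$-th coordinate of $\bar E$. Let $\Gamma$ be a *coupling operator*, i.e. a (possibly unbounded) linear operator with domain $\mathcal D(\Gamma)$ in, and values in, the bounded measurable functions on $\bar E$ such that * for all $i$ and all $f\in C_c^\infty(E)$: $f_i\in\mathcal D(\Gamma)$ and $\Gamma f_i=0$; * $\bar{\mathcal L}_\Gamma=\sum_{i=1}^n\mathcal L_i+\Gamma$ generates a Feller semigroup $(\bar S^\Gamma_t)_{t\ge0}$ on $\bar E$: as an operator in $C_0(\bar E)$ with domain the functions $F$ in $\mathcal D(\mathcal L)^{\otimes n}\cap\mathcal D(\Gamma)$ (algebraic tensor product) for which $\bar{\mathcal L}_\Gamma F\in C_0(\bar E)$, it is closable and its closure is the generator of $(\bar S_t^\Gamma)_{t\ge0}$; and on the functions $f_i$, $f\in C_c^\infty(E)$ (which need not vanish at infinity on $\bar E$), the extended generator of $(\bar S^\Gamma_t)_{t\ge0}$ is defined and equal to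 $(\mathcal Lf)_i+\Gamma f_i$. Assume that $\Gamma$ is ergodic, i.e. that $(\bar S^\Gamma_t)_{t\ge0}$ is ergodic, with invariant measure $\bar\pi_\Gamma$. Denote again by $(\bar S_t^\Gamma)_{t\ge0}$ the extension of this semigroup to $L^2(\bar\pi_\Gamma)$ (given by the same transition kernels), and by $\bar{\mathcal L}_\Gamma$, with domain $\mathcal D(\bar{\mathcal L}_\Gamma)\subset L^2(\bar\pi_\Gamma)$, the generator of this extension. With $L^2_0(\mu)=\{f\in L^2(\mu):\int f\,\mathrm d\mu=0\}$, set $$\tilde L^2_0(\bar\pi_\Gamma)=\Big\{F\in L^2_0(\bar\pi_\Gamma)\;:\;F=\tfrac1n\sum_{i=1}^n f_i\ \text{for some } f\in L^2_0(\pi)\Big\}.$$ **Theorem 6.1.** For every $\Lambda>0$ the following are equivalent: 1. (Poincaré inequality) for all $F\in\mathcal D(\bar{\mathcal L}_\Gamma)\cap\tilde L^2_0(\bar\pi_\Gamma)$, $$\langle F,F\rangle_{L^2(\bar\pi_\Gamma)}\le\frac1\Lambda\,\langle F,(-\bar{\mathcal L}_\Gamma)F\rangle_{L^2(\bar\pi_\Gamma)};$$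 2. (exponential decay) for all $F\in\tilde L_0^2(\bar\pi_\Gamma)$ and all $t\ge0$, $$\|\bar S^\Gamma_tF\|^2_{L^2(\bar\pi_\Gamma)}\le e^{-2\Lambda t}\,\|F\|^2_{L^2(\bar\pi_\Gamma)}.$$ -/

import Mathlib

open MeasureTheory ProbabilityTheory Filter Topology
open scoped NNReal ENNReal ZeroAtInfty Manifold ContDiff BoundedContinuousFunction

/-- A (conservative) Feller semigroup on `E`, given by the Markov transition kernels
`kernel t x = Law(X_t | X_0 = x)` of a Markov process: the kernels satisfy the
Chapman-Kolmogorov equations, and the induced operators leave `C₀(E)` invariant and are strongly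
continuous on it with respect to the supremum norm. -/
structure FellerSemigroup (E : Type*) [TopologicalSpace E] [MeasurableSpace E] where
  kernel : ℝ≥0 → Kernel E E
  isMarkovKernel : ∀ t, IsMarkovKernel (kernel t)
  kernel_zero : kernel 0 = Kernel.id
  kernel_add : ∀ s t, kernel (s + t) = kernel t ∘ₖ kernel s
  maps_zeroAtInfty : ∀ (t : ℝ≥0) (f : C₀(E, ℝ)),
    ∃ g : C₀(E, ℝ), ∀ x, g x = ∫ y, f y ∂(kernel t x)
  strongly_continuous : ∀ f : C₀(E, ℝ),
    TendstoUniformly (fun (t : ℝ≥0) (x : E) => ∫ y, f y ∂(kernel t x)) f (𝓝 0)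

namespace FellerSemigroup

section

variable {E : Type*} [TopologicalSpace E] [MeasurableSpace E]

/-- `(S_t f)(x) = E[f(X_t) | X_0 = x]`. For `f` square integrable with respect to an invariant
measure `μ` the same formula is defined `μ`-almost everywhere and is the continuous
extension of the semigroup to `L²(μ)`. -/
noncomputable def op (S : FellerSemigroup E) (t : ℝ≥0) (f : E → ℝ) (x : E) : ℝ :=
  ∫ y, f y ∂(S.kernel t x)

/-- The graph of the infinitesimal generator `(𝓛, D(𝓛))` on `C₀(E)`: the pairs `(f, 𝓛 f)`,
where `𝓛 f` is the limit of `(S_t f - f) / t` in supremum norm as `t ↓ 0`. -/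
def generatorGraph (S : FellerSemigroup E) : Set (C₀(E, ℝ) × C₀(E, ℝ)) :=
  {p | TendstoUniformly (fun (t : ℝ≥0) (x : E) => (S.op t p.1 x - p.1 x) / t) p.2 (𝓝[>] 0)}

/-- `f` lies in the domain of the extended generator on `C_b(E)`, and `g` is its image:
`f` is bounded and continuous, and `(S_t f - f) / t → g` uniformly on compact sets. -/
def HasExtendedGenerator (S : FellerSemigroup E) (f g : E → ℝ) : Prop :=
  Continuous f ∧ (∃ C : ℝ, ∀ x, |f x| ≤ C) ∧
    ∀ K : Set E, IsCompact K →
      TendstoUniformlyOn (fun (t : ℝ≥0) (x : E) => (S.op t f x - f x) / t) g (𝓝[>] 0) K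

/-- `F` lies in the domain of the generator of the semigroup on `L²(μ)`, and `G` is its image:
`(S_t F - F) / t → G` in `L²(μ)` as `t ↓ 0`. -/
def HasL2Generator (S : FellerSemigroup E) (μ : Measure E) (F G : E → ℝ) : Prop :=
  MemLp F 2 μ ∧ MemLp G 2 μ ∧
    Tendsto (fun t : ℝ≥0 => eLpNorm (fun x => (S.op t F x - F x) / t - G x) 2 μ)
      (𝓝[>] 0) (𝓝 0)

/-- `μ` is a probability measure with `∫ 𝓛 f dμ = 0` for all `f ∈ D(𝓛)`. -/
def IsInvariant (S : FellerSemigroup E) (μ : Measure E) : Prop :=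
  IsProbabilityMeasure μ ∧ ∀ p ∈ S.generatorGraph, ∫ x, p.2 x ∂μ = 0

/-- The process is ergodic with invariant measure `μ`: the invariant probability measure is
unique, and for every bounded continuous `f` and every starting point `x` the ergodic averages
converge, `E_x[(1/T) ∫₀ᵀ f(X_t) dt] → ∫ f dμ`. (As `f` is bounded, this follows from convergence
of the averages along the paths, be it almost surely or in probability.) -/
def IsErgodic (S : FellerSemigroup E) (μ : Measure E) : Prop :=
  S.IsInvariant μ ∧ (∀ ν : Measure E, S.IsInvariant ν → ν = μ) ∧
    ∀ (f : E →ᵇ ℝ) (x : E),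
      Tendsto (fun T : ℝ => T⁻¹ * ∫ t in (0 : ℝ)..T, S.op t.toNNReal f x) atTop
        (𝓝 (∫ y, f y ∂μ))

end

end FellerSemigroup

/-- `C_c^∞(E)`, as a set of elements of `C₀(E)`. -/
def testFunctions {V H : Type*} [NormedAddCommGroup V] [NormedSpace ℝ V] [TopologicalSpace H]
    (I : ModelWithCorners ℝ V H) (E : Type*) [TopologicalSpace E] [ChartedSpace H E] :
    Set C₀(E, ℝ) :=
  {f | ContMDiff I 𝓘(ℝ) ∞ (f : E → ℝ) ∧ HasCompactSupport (f : E → ℝ)}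

/-- A set `D` of functions is contained in the domain of the generator of `S` and is a core for it:
the graph of the generator is the closure of its restriction to `D`. -/
def FellerSemigroup.IsCore {E : Type*} [TopologicalSpace E] [MeasurableSpace E]
    (S : FellerSemigroup E) (D : Set C₀(E, ℝ)) : Prop :=
  (∀ f ∈ D, ∃ g, (f, g) ∈ S.generatorGraph) ∧
    S.generatorGraph ⊆ closure {p | p ∈ S.generatorGraph ∧ p.1 ∈ D}

/-- `𝓑_b(X)`: bounded measurable real functions. -/
def boundedMeasurable (X : Type*) [MeasurableSpace X] : Submodule ℝ (X → ℝ) where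
  carrier := {f | Measurable f ∧ ∃ C : ℝ, ∀ x, |f x| ≤ C}
  add_mem' := by
    rintro f g ⟨hf, C, hC⟩ ⟨hg, D, hD⟩
    exact ⟨hf.add hg, C + D, fun x => (abs_add_le _ _).trans (add_le_add (hC x) (hD x))⟩
  zero_mem' := ⟨measurable_const, 0, fun x => by simp⟩
  smul_mem' := by
    rintro c f ⟨hf, C, hC⟩
    refine ⟨hf.const_smul c, |c| * C, fun x => ?_⟩
    simpa [abs_mul] using mul_le_mul_of_nonneg_left (hC x) (abs_nonneg c)

section

variable {E : Type*} [TopologicalSpace E] [MeasurableSpace E] {n : ℕ}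

/-- `f_i(x_1, …, x_n) = f(x_i)`. -/
def coordFun (f : E → ℝ) (i : Fin n) (x : Fin n → E) : ℝ := f (x i)

/-- The graph of `∑ i, 𝓛_i`, where `𝓛_i` is a copy of `𝓛` acting on the `i`-th coordinate, on the
algebraic tensor product `D(𝓛) ⊗ ⋯ ⊗ D(𝓛)`: the linear span of the pairs consisting of
`f 1 ⊗ ⋯ ⊗ f n` and `∑ i, f 1 ⊗ ⋯ ⊗ 𝓛 (f i) ⊗ ⋯ ⊗ f n` with all `f i` in `D(𝓛)`. -/
def sumGeneratorGraph (S : FellerSemigroup E) (n : ℕ) :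
    Submodule ℝ (C₀(Fin n → E, ℝ) × C₀(Fin n → E, ℝ)) :=
  Submodule.span ℝ {p | ∃ f g : Fin n → C₀(E, ℝ), (∀ i, (f i, g i) ∈ S.generatorGraph) ∧
    (∀ x, p.1 x = ∏ i, f i (x i)) ∧
    (∀ x, p.2 x = ∑ i, g i (x i) * ∏ j ∈ Finset.univ.erase i, f j (x j))}

/-- The graph, in `C₀(Eⁿ)`, of `∑ i, 𝓛_i + Γ` on the domain `(D(𝓛) ⊗ ⋯ ⊗ D(𝓛)) ∩ D(Γ)`. -/
def coupledPreGeneratorGraph (S : FellerSemigroup E)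
    (Γ : boundedMeasurable (Fin n → E) →ₗ.[ℝ] boundedMeasurable (Fin n → E)) :
    Set (C₀(Fin n → E, ℝ) × C₀(Fin n → E, ℝ)) :=
  {p | ∃ h : C₀(Fin n → E, ℝ), (p.1, h) ∈ sumGeneratorGraph S n ∧
    ∃ u : Γ.domain, (∀ x, (u : boundedMeasurable (Fin n → E)).1 x = p.1 x) ∧
      ∀ x, p.2 x = h x + (Γ u).1 x}

/-- `Sbar` is the Feller semigroup on `Eⁿ` generated by `𝓛_Γ = ∑ i, 𝓛_i + Γ`: the closure in
`C₀(Eⁿ)` of `𝓛_Γ` is the generator of `Sbar` (in particular `𝓛_Γ` is closable there), and on the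
functions `f_i` with `f` in `D`, which need not vanish at infinity on `Eⁿ`, `𝓛_Γ` is given by the
extended generator of `Sbar`. Note that `(∑ j, 𝓛_j) f_i = (𝓛 f)_i`. -/
def IsCoupledSemigroup (S : FellerSemigroup E) (D : Set C₀(E, ℝ))
    (Γ : boundedMeasurable (Fin n → E) →ₗ.[ℝ] boundedMeasurable (Fin n → E))
    (Sbar : FellerSemigroup (Fin n → E)) : Prop :=
  closure (coupledPreGeneratorGraph S Γ) = Sbar.generatorGraph ∧
    ∀ (i : Fin n) (f g : C₀(E, ℝ)), f ∈ D → (f, g) ∈ S.generatorGraph →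
      ∀ u : Γ.domain, (u : boundedMeasurable (Fin n → E)).1 = coordFun f i →
        Sbar.HasExtendedGenerator (coordFun f i) (fun x => coordFun g i x + (Γ u).1 x)

/-- The set of coupling operators `Γ` (with test functions `D` on the one-particle space):
every `f_i` with `f ∈ D` belongs to `D(Γ)` and satisfies `Γ f_i = 0`, and `∑ i, 𝓛_i + Γ` generates
a Feller semigroup on `Eⁿ`. -/
def couplingOperators (S : FellerSemigroup E) (D : Set C₀(E, ℝ)) (n : ℕ) :
    Set (boundedMeasurable (Fin n → E) →ₗ.[ℝ] boundedMeasurable (Fin n → E)) :=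
  {Γ | (∀ (i : Fin n), ∀ f ∈ D, ∃ u : Γ.domain,
      (u : boundedMeasurable (Fin n → E)).1 = coordFun f i ∧ Γ u = 0) ∧
    ∃ Sbar : FellerSemigroup (Fin n → E), IsCoupledSemigroup S D Γ Sbar}

/-- The centred observables `F ∈ L²₀(πbar)` of the form `F = (1/n) ∑ i, f_i` (`πbar`-almost
everywhere) with `f ∈ L²₀(π)`. -/
def IsCentredMean (π : Measure E) (πbar : Measure (Fin n → E)) (F : (Fin n → E) → ℝ) : Prop :=
  MemLp F 2 πbar ∧ ∫ x, F x ∂πbar = 0 ∧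
    ∃ f : E → ℝ, MemLp f 2 π ∧ ∫ y, f y ∂π = 0 ∧
      F =ᵐ[πbar] fun x => (1 / (n : ℝ)) * ∑ i, coordFun f i x

end

/-! Differentiating `‖U_t F‖²` shows that coercivity of a generator and exponential decay are
equivalent along any orbit to which coercivity applies throughout. The issue is that the inequality
is only assumed for means `(1/n) ∑ f_i`, so such means must be stable under the coupled semigroup.
They are, because each coordinate of the coupled process is a copy of the one-particle process: the
`i`-th coordinate of the law `Sbar.kernel t x` is `S.kernel t (x i)`. Consequently every marginal of
`πbar` is invariant for `S` and equals `π` by uniqueness, and the map `J f = (1/n) ∑ f_i` from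
`L²₀(π)` to `L²(πbar)` intertwines the two semigroups.

`coercive_iff_decay` treats this situation abstractly. Decay is proved by Grönwall for `J x` with
`x` in the domain of the one-particle generator and extended by density in the source space, so the
range of `J` need not be closed.

The statement on coordinates is `FellerSemigroup.map_kernel_eq`. Since `Γ f_i = 0`, the coupled
generator acts on `f_i` as the one-particle generator, but `f_i` need not vanish at infinity and
`C₀` theory does not apply to it directly. A maximum principle with cutoffs
(`le_of_pointwise_generator`) identifies `f_i` as a limit of resolvents of `C₀` functions. This
gives Dynkin's formula, first on the core and then, the relation being closed, on the whole domain.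
The coordinate law thus solves the forward equation of `S`, whose solution is unique by
`eq_comp_of_hasDerivWithinAt`. -/

/-! ### Contraction semigroups: generators, resolvents, uniqueness and decay. -/

/-- A strongly continuous semigroup of contractions on a normed space. -/
structure ContractionSemigroup (X : Type*) [NormedAddCommGroup X] [NormedSpace ℝ X] where
  toFun : ℝ≥0 → X →L[ℝ] X
  zero_apply : ∀ x, toFun 0 x = x
  add_apply : ∀ s t x, toFun (s + t) x = toFun s (toFun t x)
  norm_le : ∀ t x, ‖toFun t x‖ ≤ ‖x‖
  tendsto_zero : ∀ x, Tendsto (fun t => toFun t x) (𝓝 0) (𝓝 x)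

namespace ContractionSemigroup

variable {X : Type*} [NormedAddCommGroup X] [NormedSpace ℝ X] (T : ContractionSemigroup X)

/-- The orbit of `x`, extended by the constant `x` to negative times. -/
noncomputable def orbit (x : X) (t : ℝ) : X := T.toFun t.toNNReal x

lemma orbit_zero (x : X) : T.orbit x 0 = x := by simp [orbit, T.zero_apply]

lemma orbit_coe (x : X) (t : ℝ≥0) : T.orbit x t = T.toFun t x := by simp [orbit]

lemma norm_orbit_le (x : X) (t : ℝ) : ‖T.orbit x t‖ ≤ ‖x‖ := T.norm_le _ _

lemma orbit_add (x : X) {s t : ℝ} (hs : 0 ≤ s) (ht : 0 ≤ t) :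
    T.orbit x (s + t) = T.orbit (T.orbit x t) s := by
  simp only [orbit, Real.toNNReal_add hs ht, T.add_apply]

lemma norm_sub_le (x : X) (s t : ℝ≥0) : ‖T.toFun (s + t) x - T.toFun s x‖ ≤ ‖T.toFun t x - x‖ := by
  rw [T.add_apply, ← map_sub]
  exact T.norm_le _ _

lemma continuous_toFun (x : X) : Continuous fun t => T.toFun t x := by
  rw [continuous_iff_continuousAt]
  intro s
  have key : ∀ t, ‖T.toFun t x - T.toFun s x‖ ≤ ‖T.toFun (nndist t s) x - x‖ := by
    intro t
    rcases le_total s t with h | h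
    · obtain ⟨r, rfl⟩ := exists_add_of_le h
      have : nndist (s + r) s = r := by
        ext; simp [NNReal.dist_eq]
      rw [this]
      exact T.norm_sub_le x s r
    · obtain ⟨r, rfl⟩ := exists_add_of_le h
      have : nndist t (t + r) = r := by
        ext; simp [NNReal.dist_eq]
      rw [this, norm_sub_rev]
      exact T.norm_sub_le x t r
  rw [ContinuousAt, tendsto_iff_norm_sub_tendsto_zero]
  refine squeeze_zero (fun _ => norm_nonneg _) key ?_
  have h1 : Tendsto (fun t => nndist t s) (𝓝 s) (𝓝 0) := by
    have : Continuous fun t : ℝ≥0 => nndist t s := by fun_prop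
    simpa using this.tendsto s
  have h2 := (T.tendsto_zero x).comp h1
  simpa using (tendsto_iff_norm_sub_tendsto_zero.1 h2)

lemma continuous_orbit (x : X) : Continuous (T.orbit x) :=
  (T.continuous_toFun x).comp continuous_real_toNNReal

/-- `x` lies in the domain of the generator, with image `y`. -/
def HasGenerator (x y : X) : Prop := HasDerivWithinAt (T.orbit x) y (Set.Ici 0) 0

lemma map_coe_nhdsGT_zero : map ((↑) : ℝ≥0 → ℝ) (𝓝[>] 0) = 𝓝[>] 0 := by
  have h := (NNReal.isEmbedding_coe).map_nhdsWithin_eq (Set.Ioi 0) 0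
  rw [h]
  congr 1
  ext x
  simp only [Set.mem_image, Set.mem_Ioi]
  exact ⟨fun ⟨y, hy, h⟩ => h ▸ hy, fun hx => ⟨⟨x, hx.le⟩, hx, rfl⟩⟩

lemma hasGenerator_iff (x y : X) : T.HasGenerator x y ↔
    Tendsto (fun t : ℝ≥0 => (t : ℝ)⁻¹ • (T.toFun t x - x)) (𝓝[>] 0) (𝓝 y) := by
  rw [HasGenerator, hasDerivWithinAt_iff_tendsto_slope, Set.Ici_sdiff_left,
    ← map_coe_nhdsGT_zero, tendsto_map'_iff]
  refine tendsto_congr fun t => ?_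
  simp [slope, orbit_coe, orbit_zero]

lemma HasGenerator.apply {T : ContractionSemigroup X} {x y : X} (h : T.HasGenerator x y) {t : ℝ} :
    T.HasGenerator (T.orbit x t) (T.orbit y t) := by
  have := (T.toFun t.toNNReal).hasFDerivAt.comp_hasDerivWithinAt (0 : ℝ) h
  rw [HasGenerator]
  refine this.congr_of_mem (fun s hs => ?_) Set.self_mem_Ici
  simp only [orbit, Function.comp, ← T.add_apply, add_comm]

lemma HasGenerator.hasDerivWithinAt {T : ContractionSemigroup X} {x y : X}
    (h : T.HasGenerator x y) {t : ℝ} (ht : 0 ≤ t) :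
    HasDerivWithinAt (T.orbit x) (T.orbit y t) (Set.Ici t) t := by
  have h1 : HasDerivWithinAt (T.orbit (T.orbit x t)) (T.orbit y t) (Set.Ici 0) (t - t) := by
    rw [sub_self]
    exact h.apply
  have h2 := h1.scomp (h := fun s => s - t) t ((hasDerivAt_id t).sub_const t).hasDerivWithinAt
    (s := Set.Ici t) (fun s hs => by simpa using hs)
  rw [one_smul] at h2
  refine h2.congr_of_mem (fun s hs => ?_) Set.self_mem_Ici
  have := T.orbit_add x (sub_nonneg.2 hs) ht
  simpa using this

section Integrals

variable [CompleteSpace X]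

lemma toFun_intervalIntegral (x : X) (φ : ℝ → ℝ) (hφ : Continuous φ) (a b : ℝ) (h : ℝ≥0) :
    T.toFun h (∫ s in a..b, φ s • T.orbit x s) = ∫ s in a..b, φ s • T.toFun h (T.orbit x s) := by
  rw [← ContinuousLinearMap.intervalIntegral_comp_comm]
  · simp
  · exact (hφ.smul (T.continuous_orbit x)).intervalIntegrable _ _

/-- Shifting the time window moves only its endpoints, so the orbit of an average is differentiable
by the fundamental theorem of calculus. Rescaled averages then give density of the domain. -/
lemma hasGenerator_average (x : X) {ε : ℝ} (hε : 0 ≤ ε) :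
    T.HasGenerator (∫ s in (0 : ℝ)..ε, T.orbit x s) (T.orbit x ε - x) := by
  have hc := T.continuous_orbit x
  have key : ∀ h ∈ Set.Ici (0 : ℝ), T.orbit (∫ s in (0 : ℝ)..ε, T.orbit x s) h =
      (∫ s in (0 : ℝ)..ε + h, T.orbit x s) - ∫ s in (0 : ℝ)..h, T.orbit x s := by
    intro h hh
    have h1 := T.toFun_intervalIntegral x (fun _ => 1) continuous_const 0 ε h.toNNReal
    simp only [one_smul] at h1
    rw [orbit, h1, intervalIntegral.integral_interval_sub_left (hc.intervalIntegrable _ _)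
      (hc.intervalIntegrable _ _)]
    have h2 : ∫ s in (0 : ℝ)..ε, T.toFun h.toNNReal (T.orbit x s) =
        ∫ s in (0 : ℝ)..ε, T.orbit x (s + h) := by
      refine intervalIntegral.integral_congr fun s hs => ?_
      rw [Set.uIcc_of_le hε] at hs
      rw [add_comm, T.orbit_add x hh hs.1]
      rfl
    rw [h2, intervalIntegral.integral_comp_add_right, zero_add]
  have d1 : HasDerivAt (fun h => ∫ s in (0 : ℝ)..ε + h, T.orbit x s) (T.orbit x ε) 0 := by
    have := (hc.integral_hasStrictDerivAt 0 (ε + 0)).hasDerivAt.comp_const_add ε 0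
    simpa using this
  have d2 : HasDerivAt (fun h => ∫ s in (0 : ℝ)..h, T.orbit x s) x 0 := by
    have := (hc.integral_hasStrictDerivAt 0 0).hasDerivAt
    simpa [orbit_zero] using this
  exact (d1.sub d2).hasDerivWithinAt.congr_of_mem key Set.self_mem_Ici

omit [CompleteSpace X] in
lemma HasGenerator.smul {T : ContractionSemigroup X} {x y : X} (h : T.HasGenerator x y) (c : ℝ) :
    T.HasGenerator (c • x) (c • y) := by
  have := HasDerivWithinAt.const_smul c h
  refine this.congr_of_mem (fun s _ => ?_) Set.self_mem_Ici
  simp [orbit]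

lemma tendsto_average (x : X) :
    Tendsto (fun ε : ℝ => ε⁻¹ • ∫ s in (0 : ℝ)..ε, T.orbit x s) (𝓝[>] 0) (𝓝 x) := by
  have hc := T.continuous_orbit x
  have d2 : HasDerivAt (fun h => ∫ s in (0 : ℝ)..h, T.orbit x s) x 0 := by
    have := (hc.integral_hasStrictDerivAt 0 0).hasDerivAt
    simpa [orbit_zero] using this
  have := (hasDerivWithinAt_iff_tendsto_slope.1 (d2.hasDerivWithinAt (s := Set.Ici 0)))
  rw [Set.Ici_sdiff_left] at this
  simpa [slope_fun_def] using this

lemma dense_domain : Dense {x | ∃ y, T.HasGenerator x y} := by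
  intro x
  refine mem_closure_of_tendsto (T.tendsto_average x) ?_
  filter_upwards [self_mem_nhdsWithin] with ε hε
  exact ⟨_, (T.hasGenerator_average x (le_of_lt hε)).smul _⟩

/-- The resolvent at `1`. -/
noncomputable def resolvent (x : X) : X := ∫ t in Set.Ioi (0 : ℝ), Real.exp (-t) • T.orbit x t

omit [CompleteSpace X] in
lemma integrableOn_resolvent (x : X) :
    IntegrableOn (fun t => Real.exp (-t) • T.orbit x t) (Set.Ioi (0 : ℝ)) := by
  have h1 : IntegrableOn (fun t : ℝ => Real.exp (-t) * ‖x‖) (Set.Ioi 0) :=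
    (integrableOn_exp_neg_Ioi 0).mul_const _
  refine Integrable.mono' h1 ?_ (Eventually.of_forall fun t => ?_)
  · have := T.continuous_orbit x
    exact (Continuous.aestronglyMeasurable (by fun_prop))
  · rw [norm_smul, Real.norm_eq_abs, Real.abs_exp]
    exact mul_le_mul_of_nonneg_left (T.norm_orbit_le x t) (Real.exp_nonneg _)

/-- Substitute `s + t` for `s` in the Laplace integral. Time enters the right-hand side only through
an exponential and an upper limit of integration, so it can be differentiated, and later passed to a
limit of cutoffs. -/
lemma orbit_resolvent (x : X) {t : ℝ} (ht : 0 ≤ t) :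
    T.orbit (T.resolvent x) t =
      Real.exp t • (T.resolvent x - ∫ s in (0 : ℝ)..t, Real.exp (-s) • T.orbit x s) := by
  have hi := T.integrableOn_resolvent x
  have h1 : T.resolvent x - ∫ s in (0 : ℝ)..t, Real.exp (-s) • T.orbit x s =
      ∫ s in Set.Ioi t, Real.exp (-s) • T.orbit x s := by
    rw [resolvent, ← intervalIntegral.integral_Ioi_sub_Ioi hi ht, sub_sub_cancel]
  have h2 : ∫ s in Set.Ioi t, Real.exp (-s) • T.orbit x s =
      ∫ s in Set.Ioi (0 : ℝ), Real.exp (-(s + t)) • T.orbit x (s + t) := by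
    have := (measurePreserving_add_right volume t).setIntegral_preimage_emb
      (measurableEmbedding_addRight t) (fun s => Real.exp (-s) • T.orbit x s) (Set.Ioi t)
    rw [← this]
    simp
  rw [h1, h2, ← integral_smul, orbit, resolvent, ← ContinuousLinearMap.integral_comp_comm _ hi]
  refine setIntegral_congr_fun measurableSet_Ioi fun s hs => ?_
  rw [map_smul, smul_smul, ← Real.exp_add, add_comm s t, T.orbit_add x ht (le_of_lt hs)]
  congr 2
  ring

lemma hasGenerator_resolvent (x : X) :
    T.HasGenerator (T.resolvent x) (T.resolvent x - x) := by
  have hc : Continuous fun s => Real.exp (-s) • T.orbit x s := by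
    have := T.continuous_orbit x
    fun_prop
  have d2 : HasDerivAt (fun h => ∫ s in (0 : ℝ)..h, Real.exp (-s) • T.orbit x s) x 0 := by
    have := (hc.integral_hasStrictDerivAt 0 0).hasDerivAt
    simpa [orbit_zero] using this
  have d3 := (Real.hasDerivAt_exp 0).smul (d2.const_sub (T.resolvent x))
  have d4 : HasDerivAt (fun t => Real.exp t •
      (T.resolvent x - ∫ s in (0 : ℝ)..t, Real.exp (-s) • T.orbit x s))
      (T.resolvent x - x) 0 := by
    rw [Real.exp_zero, one_smul, one_smul, intervalIntegral.integral_same, sub_zero,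
      neg_add_eq_sub] at d3
    exact d3
  exact d4.hasDerivWithinAt.congr_of_mem (fun t ht => T.orbit_resolvent x ht) Set.self_mem_Ici

end Integrals

/-- Both sides are continuous and share right derivatives. The integral form upgrades the one-sided
derivative to a two-sided one at positive times. -/
lemma HasGenerator.orbit_eq [CompleteSpace X] {T : ContractionSemigroup X} {x y : X}
    (h : T.HasGenerator x y) {t : ℝ} (ht : 0 ≤ t) :
    T.orbit x t = x + ∫ s in (0 : ℝ)..t, T.orbit y s := by
  have hc := T.continuous_orbit y
  refine eq_of_has_deriv_right_eq (f := T.orbit x) (f' := T.orbit y) (a := 0) (b := t)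
    (g := fun t => x + ∫ s in (0 : ℝ)..t, T.orbit y s)
    (fun s hs => h.hasDerivWithinAt hs.1) (fun s _ => ?_) (T.continuous_orbit x).continuousOn
    (fun s _ => ?_) (by simp [orbit_zero]) t ⟨ht, le_rfl⟩
  · exact ((hc.integral_hasStrictDerivAt 0 s).hasDerivAt.const_add x).hasDerivWithinAt
  · exact ((hc.integral_hasStrictDerivAt 0 s).hasDerivAt.const_add
      x).continuousAt.continuousWithinAt

lemma HasGenerator.hasDerivAt [CompleteSpace X] {T : ContractionSemigroup X} {x y : X}
    (h : T.HasGenerator x y) {t : ℝ} (ht : 0 < t) :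
    HasDerivAt (T.orbit x) (T.orbit y t) t := by
  have hc := T.continuous_orbit y
  refine ((hc.integral_hasStrictDerivAt 0 t).hasDerivAt.const_add x).congr_of_eventuallyEq ?_
  filter_upwards [eventually_ge_nhds ht] with s hs using h.orbit_eq hs

/-- A family of contractions `ℓ t` that solves `(d/dt) ℓ t x = ℓ t (A x)` on the domain of the
generator `A` of `T` is `ℓ 0 ∘ T t`. -/
lemma eq_comp_of_hasDerivWithinAt [CompleteSpace X] {Y : Type*} [NormedAddCommGroup Y]
    [NormedSpace ℝ Y] (ℓ : ℝ → X →L[ℝ] Y) (hℓ : ∀ t x, ‖ℓ t x‖ ≤ ‖x‖)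
    (hcont : ∀ x, Continuous fun t => ℓ t x)
    (hderiv : ∀ x y, T.HasGenerator x y → ∀ t, 0 ≤ t →
      HasDerivWithinAt (fun s => ℓ s x) (ℓ t y) (Set.Ici t) t)
    (x : X) {t : ℝ} (ht : 0 ≤ t) : ℓ t x = ℓ 0 (T.orbit x t) := by
  -- The uniform bound on `ℓ` turns separate continuity into joint continuity.
  have joint : ∀ {l : Filter ℝ} {s : ℝ} {z : ℝ → X} {w : X}, l ≤ 𝓝 s → Tendsto z l (𝓝 w) →
      Tendsto (fun r => ℓ r (z r)) l (𝓝 (ℓ s w)) := by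
    intro l s z w hl hz
    have h1 : Tendsto (fun r => ℓ r (z r - w)) l (𝓝 0) := by
      rw [tendsto_zero_iff_norm_tendsto_zero]
      exact squeeze_zero (fun _ => norm_nonneg _) (fun r => hℓ r _)
        (tendsto_iff_norm_sub_tendsto_zero.1 hz)
    have h2 := h1.add (((hcont w).tendsto s).mono_left hl)
    simpa using h2
  suffices hD : ∀ x ∈ {x | ∃ y, T.HasGenerator x y}, ℓ t x = ℓ 0 (T.orbit x t) by
    have := Continuous.ext_on T.dense_domain (ℓ t).continuous
      ((ℓ 0).continuous.comp (T.toFun t.toNNReal).continuous) hD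
    exact congr_fun this x
  rintro x ⟨y, hxy⟩
  -- Interpolate: `s ↦ ℓ s (T_{t-s} x)` joins `ℓ 0 (T_t x)` to `ℓ t x`, and the two contributions to
  -- its right derivative cancel.
  have hg : Continuous fun s => T.orbit x (t - s) := (T.continuous_orbit x).comp (by fun_prop)
  have hφ : Continuous fun s => ℓ s (T.orbit x (t - s)) :=
    continuous_iff_continuousAt.2 fun s => joint le_rfl (hg.tendsto s)
  have := constant_of_has_deriv_right_zero (f := fun s => ℓ s (T.orbit x (t - s)))
    (a := 0) (b := t) hφ.continuousOn ?_ t ⟨ht, le_rfl⟩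
  · simpa [orbit_zero] using this
  intro s hs
  have hts : 0 < t - s := sub_pos.2 hs.2
  have d1 : HasDerivAt (fun s => T.orbit x (t - s)) (-T.orbit y (t - s)) s := by
    have := (hxy.hasDerivAt hts).scomp s ((hasDerivAt_id s).const_sub t)
    rwa [neg_one_smul] at this
  have d2 := hderiv _ _ (hxy.apply (t := t - s)) s hs.1
  rw [hasDerivWithinAt_iff_tendsto_slope, Set.Ici_sdiff_left] at d2 ⊢
  have d3 := hasDerivWithinAt_iff_tendsto_slope.1 (d1.hasDerivWithinAt (s := Set.Ici s))
  rw [Set.Ici_sdiff_left] at d3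
  have d4 := (joint (nhdsWithin_le_nhds (s := Set.Ioi s)) d3).add d2
  rw [map_neg, neg_add_cancel] at d4
  refine d4.congr fun r => ?_
  simp only [slope, vsub_eq_sub, map_smul, map_sub, ← smul_add]
  congr 1
  abel

/-- Equivalence of coercivity of the generator and exponential decay, on the range of
an operator that intertwines two semigroups. -/
theorem coercive_iff_decay [CompleteSpace X] {Y : Type*} [NormedAddCommGroup Y]
    [InnerProductSpace ℝ Y] (U : ContractionSemigroup Y) (J : X →L[ℝ] Y)
    (hJ : ∀ t x, J (T.toFun t x) = U.toFun t (J x)) {Λ : ℝ} (hΛ : 0 < Λ) :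
    (∀ x y, U.HasGenerator (J x) y → ‖J x‖ ^ 2 ≤ 1 / Λ * inner ℝ (J x) (-y)) ↔
      ∀ x (t : ℝ≥0), ‖U.toFun t (J x)‖ ^ 2 ≤ Real.exp (-2 * Λ * t) * ‖J x‖ ^ 2 := by
  have hJo : ∀ x t, J (T.orbit x t) = U.orbit (J x) t := fun x t => hJ _ _
  constructor
  · intro hP x t
    -- For fixed `t` the inequality is a closed condition on `x`, so the dense domain of the
    -- generator of `T` suffices.
    suffices hD : Dense {x | ‖U.toFun t (J x)‖ ^ 2 ≤ Real.exp (-2 * Λ * t) * ‖J x‖ ^ 2} by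
      have hcl : IsClosed {x | ‖U.toFun t (J x)‖ ^ 2 ≤ Real.exp (-2 * Λ * t) * ‖J x‖ ^ 2} :=
        isClosed_le (by fun_prop) (by fun_prop)
      have := hcl.closure_eq ▸ hD x
      exact this
    refine T.dense_domain.mono ?_
    rintro x ⟨y, hxy⟩
    have hJxy : U.HasGenerator (J x) (J y) :=
      (J.hasFDerivAt.comp_hasDerivWithinAt (0 : ℝ) hxy).congr_of_mem
        (fun s _ => (hJo x s).symm) Set.self_mem_Ici
    -- Grönwall: the weighted squared norm `exp (2Λs) ‖U_s J x‖²` has nonpositive right derivative.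
    have hd : ∀ s, 0 ≤ s → HasDerivWithinAt
        (fun s => Real.exp (2 * Λ * s) * ‖U.orbit (J x) s‖ ^ 2)
        (Real.exp (2 * Λ * s) * (2 * Λ) * ‖U.orbit (J x) s‖ ^ 2 +
          Real.exp (2 * Λ * s) * (2 * inner ℝ (U.orbit (J x) s) (U.orbit (J y) s)))
        (Set.Ici s) s := by
      intro s hs
      have e : HasDerivAt (fun s => Real.exp (2 * Λ * s)) (Real.exp (2 * Λ * s) * (2 * Λ)) s := by
        have := ((hasDerivAt_id s).const_mul (2 * Λ)).exp
        simpa using this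
      exact e.hasDerivWithinAt.mul (hJxy.hasDerivWithinAt hs).norm_sq
    have hc : Continuous fun s => Real.exp (2 * Λ * s) * ‖U.orbit (J x) s‖ ^ 2 := by
      have := U.continuous_orbit (J x)
      fun_prop
    have := image_le_of_deriv_right_le_deriv_boundary (a := 0) (b := t) hc.continuousOn
      (fun s hs => hd s hs.1) (B := fun _ => ‖J x‖ ^ 2) (B' := fun _ => 0)
      (by simp [orbit_zero]) continuousOn_const (fun s _ => hasDerivWithinAt_const _ _ _) ?_
      (x := t) ⟨t.2, le_rfl⟩
    · simp only [orbit_coe] at this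
      rw [Set.mem_ofPred_eq, show -2 * Λ * (t : ℝ) = -(2 * Λ * t) by ring, Real.exp_neg,
        ← div_eq_inv_mul, le_div_iff₀ (Real.exp_pos _), mul_comm]
      exact this
    · intro s hs
      -- Intertwining is decisive here: `U_s (J x) = J (T_s x)` is again in the range of `J`, so
      -- coercivity applies at every time.
      have h1 := hP (T.orbit x s) (U.orbit (J y) s) (by rw [hJo]; exact hJxy.apply)
      rw [hJo, inner_neg_right, div_mul_eq_mul_div, one_mul, le_div_iff₀ hΛ] at h1
      have h2 := Real.exp_pos (2 * Λ * s)
      have : Real.exp (2 * Λ * s) * (2 * Λ) * ‖U.orbit (J x) s‖ ^ 2 +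
          Real.exp (2 * Λ * s) * (2 * inner ℝ (U.orbit (J x) s) (U.orbit (J y) s)) =
          2 * Real.exp (2 * Λ * s) * (‖U.orbit (J x) s‖ ^ 2 * Λ +
            inner ℝ (U.orbit (J x) s) (U.orbit (J y) s)) := by ring
      rw [this]
      exact mul_nonpos_of_nonneg_of_nonpos (by positivity) (by linarith)
  · intro hE x y hxy
    have d1 : HasDerivWithinAt (fun s => ‖U.orbit (J x) s‖ ^ 2)
        (2 * inner ℝ (J x) y) (Set.Ici 0) 0 := by
      simpa [orbit_zero] using HasDerivWithinAt.norm_sq hxy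
    have d2 : HasDerivWithinAt (fun s => Real.exp (-2 * Λ * s) * ‖J x‖ ^ 2)
        (-2 * Λ * ‖J x‖ ^ 2) (Set.Ici 0) 0 := by
      have := (((hasDerivAt_id (0 : ℝ)).const_mul (-2 * Λ)).exp.mul_const
        (‖J x‖ ^ 2)).hasDerivWithinAt (s := Set.Ici 0)
      simpa using this
    rw [hasDerivWithinAt_iff_tendsto_slope, Set.Ici_sdiff_left] at d1 d2
    -- The two sides of the decay inequality agree at time `0`, so their right derivatives there are
    -- ordered in the same way.
    have hle : 2 * inner ℝ (J x) y ≤ -2 * Λ * ‖J x‖ ^ 2 := by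
      refine le_of_tendsto_of_tendsto d1 d2 ?_
      filter_upwards [self_mem_nhdsWithin] with s hs
      have hs : (0 : ℝ) < s := hs
      have : ‖U.toFun ⟨s, hs.le⟩ (J x)‖ ^ 2 ≤ Real.exp (-2 * Λ * s) * ‖J x‖ ^ 2 := hE x ⟨s, hs.le⟩
      have h2 : U.toFun ⟨s, hs.le⟩ (J x) = U.orbit (J x) s := (U.orbit_coe _ _).symm
      rw [h2] at this
      simp only [slope, vsub_eq_sub, sub_zero, orbit_zero, smul_eq_mul]
      refine mul_le_mul_of_nonneg_left ?_ (inv_nonneg.2 hs.le)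
      simpa using this
    rw [inner_neg_right, div_mul_eq_mul_div, one_mul, le_div_iff₀ hΛ]
    linarith

end ContractionSemigroup

/-! ### Feller semigroups as contraction semigroups on `C₀`. -/

namespace ZeroAtInftyContinuousMap

variable {E : Type*} [TopologicalSpace E]

lemma norm_apply_le (f : C₀(E, ℝ)) (x : E) : ‖f x‖ ≤ ‖f‖ :=
  f.toBCF.norm_coe_le_norm x

lemma norm_le_of_forall {f : C₀(E, ℝ)} {C : ℝ} (hC : 0 ≤ C) (h : ∀ x, ‖f x‖ ≤ C) : ‖f‖ ≤ C :=
  (BoundedContinuousFunction.norm_le (f := f.toBCF) hC).2 h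

lemma integrable [MeasurableSpace E] [OpensMeasurableSpace E] (f : C₀(E, ℝ)) (μ : Measure E)
    [IsFiniteMeasure μ] : Integrable f μ :=
  f.toBCF.integrable μ

/-- Evaluation at a point, as a continuous linear functional. -/
noncomputable def evalCLM (x : E) : C₀(E, ℝ) →L[ℝ] ℝ :=
  LinearMap.mkContinuous ⟨⟨fun f => f x, fun _ _ => rfl⟩, fun _ _ => rfl⟩ 1
    fun f => by simpa using f.norm_apply_le x

@[simp] lemma evalCLM_apply (x : E) (f : C₀(E, ℝ)) : evalCLM x f = f x := rfl

/-- Integration against a probability measure, as a continuous linear functional. -/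
noncomputable def integralCLM [MeasurableSpace E] [OpensMeasurableSpace E] (μ : Measure E)
    [IsProbabilityMeasure μ] : C₀(E, ℝ) →L[ℝ] ℝ :=
  LinearMap.mkContinuous ⟨⟨fun f => ∫ x, f x ∂μ,
      fun f g => integral_add (f.integrable μ) (g.integrable μ)⟩,
      fun c f => integral_const_mul c f⟩ 1
    fun f => by
      have := norm_integral_le_of_norm_le_const (μ := μ) (Eventually.of_forall f.norm_apply_le)
      simpa using this

@[simp] lemma integralCLM_apply [MeasurableSpace E] [OpensMeasurableSpace E] (μ : Measure E)
    [IsProbabilityMeasure μ] (f : C₀(E, ℝ)) : integralCLM μ f = ∫ x, f x ∂μ := rfl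

end ZeroAtInftyContinuousMap

namespace FellerSemigroup

section

variable {E : Type*} [TopologicalSpace E] [MeasurableSpace E]

instance (S : FellerSemigroup E) (t : ℝ≥0) : IsMarkovKernel (S.kernel t) := S.isMarkovKernel t

/-- `S_t f` as an element of `C₀(E)`. -/
noncomputable def zeroAtInftyOp (S : FellerSemigroup E) (t : ℝ≥0) (f : C₀(E, ℝ)) : C₀(E, ℝ) :=
  Classical.choose (S.maps_zeroAtInfty t f)

lemma zeroAtInftyOp_apply (S : FellerSemigroup E) (t : ℝ≥0) (f : C₀(E, ℝ)) (x : E) :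
    S.zeroAtInftyOp t f x = ∫ y, f y ∂(S.kernel t x) :=
  Classical.choose_spec (S.maps_zeroAtInfty t f) x

variable [OpensMeasurableSpace E]

/-- The action of a Feller semigroup on `C₀(E)`. -/
noncomputable def semigroup (S : FellerSemigroup E) : ContractionSemigroup C₀(E, ℝ) where
  toFun t := LinearMap.mkContinuous
    ⟨⟨S.zeroAtInftyOp t, fun f h => by
      ext x
      simp only [zeroAtInftyOp_apply, ZeroAtInftyContinuousMap.add_apply]
      exact integral_add (f.integrable _) (h.integrable _)⟩, fun c f => by
      ext x
      simp [zeroAtInftyOp_apply, integral_const_mul]⟩ 1 fun f => by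
    rw [one_mul]
    refine ZeroAtInftyContinuousMap.norm_le_of_forall (norm_nonneg _) fun x => ?_
    have := norm_integral_le_of_norm_le_const (μ := S.kernel t x)
      (Eventually.of_forall f.norm_apply_le)
    simpa [zeroAtInftyOp_apply] using this
  zero_apply f := by
    ext x
    simp only [LinearMap.mkContinuous_apply, LinearMap.coe_mk, AddHom.coe_mk, zeroAtInftyOp_apply,
      S.kernel_zero, Kernel.id_apply]
    exact integral_dirac' _ _ f.continuous.stronglyMeasurable
  add_apply s t f := by
    ext x
    simp only [LinearMap.mkContinuous_apply, LinearMap.coe_mk, AddHom.coe_mk, zeroAtInftyOp_apply]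
    rw [add_comm, add_comm, S.kernel_add, Kernel.integral_comp (f.integrable _)]
  norm_le t f := by
    refine ZeroAtInftyContinuousMap.norm_le_of_forall (norm_nonneg _) fun x => ?_
    have := norm_integral_le_of_norm_le_const (μ := S.kernel t x)
      (Eventually.of_forall f.norm_apply_le)
    simpa [zeroAtInftyOp_apply] using this
  tendsto_zero f := by
    rw [ZeroAtInftyContinuousMap.tendsto_iff_tendstoUniformly]
    convert S.strongly_continuous f using 3
    exact zeroAtInftyOp_apply _ _ _ _

lemma semigroup_apply (S : FellerSemigroup E) (t : ℝ≥0) (f : C₀(E, ℝ)) (x : E) :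
    S.semigroup.toFun t f x = ∫ y, f y ∂(S.kernel t x) :=
  S.zeroAtInftyOp_apply t f x

lemma mem_generatorGraph_iff (S : FellerSemigroup E) (f g : C₀(E, ℝ)) :
    (f, g) ∈ S.generatorGraph ↔ S.semigroup.HasGenerator f g := by
  rw [ContractionSemigroup.hasGenerator_iff,
    ZeroAtInftyContinuousMap.tendsto_iff_tendstoUniformly]
  refine tendstoUniformly_congr (Eventually.of_forall fun t => funext fun x => ?_)
  simp [op, semigroup_apply, div_eq_inv_mul]

end

/-! ### Invariant measures: infinitesimal and semigroup forms. -/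

section Invariant

lemma integral_measure_comp {α β : Type*} [MeasurableSpace α] [MeasurableSpace β]
    {κ : Kernel α β} [IsSFiniteKernel κ] {μ : Measure α} [SFinite μ] {f : β → ℝ}
    (hf : Integrable f (κ ∘ₘ μ)) :
    ∫ y, f y ∂(κ ∘ₘ μ) = ∫ x, ∫ y, f y ∂(κ x) ∂μ := by
  rw [Measure.comp_eq_comp_const_apply] at hf ⊢
  rw [Kernel.integral_comp hf, Kernel.const_apply]

variable {E : Type*} [TopologicalSpace E] [MeasurableSpace E] [LocallyCompactSpace E]
  [PolishSpace E] [BorelSpace E]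

/-- A finite measure is determined by the integrals of functions vanishing at infinity. -/
lemma measure_ext {μ ν : Measure E} [IsFiniteMeasure μ] [IsFiniteMeasure ν]
    (h : ∀ f : C₀(E, ℝ), ∫ x, f x ∂μ = ∫ x, f x ∂ν) : μ = ν := by
  let := TopologicalSpace.upgradeIsCompletelyMetrizable E
  refine Measure.ext_of_integral_eq_on_compactlySupported fun f => ?_
  exact h (f : C₀(E, ℝ))

/-- Integration against `μ`, as a family constant in time, solves the forward equation because `μ`
annihilates the range of the generator. Uniqueness of solutions gives `∫ S_t f dμ = ∫ f dμ`. -/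
lemma IsInvariant.bind_eq {S : FellerSemigroup E} {μ : Measure E} (h : S.IsInvariant μ)
    (t : ℝ≥0) : S.kernel t ∘ₘ μ = μ := by
  have := h.1
  refine measure_ext fun f => ?_
  rw [integral_measure_comp (f.integrable _)]
  simp only [← semigroup_apply]
  have := ContractionSemigroup.eq_comp_of_hasDerivWithinAt S.semigroup
    (fun _ => ZeroAtInftyContinuousMap.integralCLM μ) (fun _ f => ?_) (fun _ => continuous_const)
    ?_ f t.2
  · simpa [ContractionSemigroup.orbit] using this.symm
  · have := norm_integral_le_of_norm_le_const (μ := μ) (Eventually.of_forall f.norm_apply_le)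
    simpa using this
  · intro f g hfg t ht
    have := h.2 (f, g) ((S.mem_generatorGraph_iff f g).2 hfg)
    simp only at this
    simp only [ZeroAtInftyContinuousMap.integralCLM_apply, this]
    exact hasDerivWithinAt_const _ _ _

/-- This converse is needed because the uniqueness contained in ergodicity is phrased through the
generator. -/
lemma isInvariant_of_bind_eq {S : FellerSemigroup E} {μ : Measure E} [IsProbabilityMeasure μ]
    (h : ∀ t, S.kernel t ∘ₘ μ = μ) : S.IsInvariant μ := by
  refine ⟨inferInstance, fun ⟨f, g⟩ hfg => ?_⟩
  rw [mem_generatorGraph_iff, ContractionSemigroup.hasGenerator_iff] at hfg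
  have h1 := ((ZeroAtInftyContinuousMap.integralCLM μ).continuous.tendsto g).comp hfg
  refine tendsto_nhds_unique h1 ((tendsto_const_nhds (x := (0 : ℝ))).congr fun t => ?_)
  have h2 : ∫ x, S.semigroup.toFun t f x ∂μ = ∫ x, f x ∂μ := by
    simp only [semigroup_apply]
    rw [← integral_measure_comp (f.integrable _), h]
  simp only [Function.comp, map_smul, map_sub, ZeroAtInftyContinuousMap.integralCLM_apply, h2,
    sub_self, smul_zero]

end Invariant

end FellerSemigroup

/-! ### Markov kernels as contractions of `L²`. -/

section KernelL2

variable {α : Type*} [MeasurableSpace α] {κ : Kernel α α} {μ : Measure α}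

/-- Invariance makes a `μ`-null set `κ x`-null for almost every `x`; this is why the kernel acts on
`L²` classes. -/
lemma integral_kernel_congr_ae (hκ : κ ∘ₘ μ = μ) {F G : α → ℝ} (h : F =ᵐ[μ] G) :
    (fun x => ∫ y, F y ∂(κ x)) =ᵐ[μ] fun x => ∫ y, G y ∂(κ x) := by
  rw [← hκ] at h
  filter_upwards [Measure.ae_ae_of_ae_comp h] with x hx using integral_congr_ae hx

lemma aestronglyMeasurable_integral_kernel (hκ : κ ∘ₘ μ = μ) {F : α → ℝ}
    (hF : AEStronglyMeasurable F μ) : AEStronglyMeasurable (fun x => ∫ y, F y ∂(κ x)) μ :=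
  ⟨_, hF.stronglyMeasurable_mk.integral_kernel, integral_kernel_congr_ae hκ hF.ae_eq_mk⟩

variable [IsMarkovKernel κ]

/-- Jensen's inequality under each probability measure `κ x`, then integration in `x` using
invariance. -/
lemma eLpNorm_integral_kernel_le (hκ : κ ∘ₘ μ = μ) {F : α → ℝ}
    (hF : AEStronglyMeasurable F μ) :
    eLpNorm (fun x => ∫ y, F y ∂(κ x)) 2 μ ≤ eLpNorm F 2 μ := by
  wlog hm : StronglyMeasurable F generalizing F
  · rw [eLpNorm_congr_ae (integral_kernel_congr_ae hκ hF.ae_eq_mk), eLpNorm_congr_ae hF.ae_eq_mk]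
    exact this hF.stronglyMeasurable_mk.aestronglyMeasurable hF.stronglyMeasurable_mk
  have hsq : ∀ (ν : Measure α) (f : α → ℝ), 
      eLpNorm f 2 ν = (∫⁻ x, ‖f x‖ₑ ^ (2 : ℝ) ∂ν) ^ (1 / 2 : ℝ) := by
    intro ν f
    rw [eLpNorm_eq_lintegral_rpow_enorm_toReal (by norm_num) (by norm_num)]
    simp
  rw [hsq, hsq]
  refine ENNReal.rpow_le_rpow ?_ (by norm_num)
  have hmeas : Measurable fun x => ‖F x‖ₑ ^ (2 : ℝ) := hm.measurable.enorm.pow_const _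
  calc ∫⁻ x, ‖∫ y, F y ∂(κ x)‖ₑ ^ (2 : ℝ) ∂μ ≤ ∫⁻ x, ∫⁻ y, ‖F y‖ₑ ^ (2 : ℝ) ∂(κ x) ∂μ := by
        refine lintegral_mono fun x => ?_
        have h1 : ‖∫ y, F y ∂(κ x)‖ₑ ≤ eLpNorm F 2 (κ x) := by
          refine (enorm_integral_le_lintegral_enorm _).trans ?_
          rw [← eLpNorm_one_eq_lintegral_enorm]
          exact eLpNorm_le_eLpNorm_of_exponent_le (by norm_num) hm.aestronglyMeasurable
        refine (ENNReal.rpow_le_rpow h1 (by norm_num)).trans ?_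
        rw [hsq, ← ENNReal.rpow_mul]
        norm_num
    _ = ∫⁻ y, ‖F y‖ₑ ^ (2 : ℝ) ∂(κ ∘ₘ μ) := by
        rw [Measure.lintegral_bind κ.aemeasurable hmeas.aemeasurable]
    _ = _ := by rw [hκ]

lemma MeasureTheory.MemLp.integral_kernel (hκ : κ ∘ₘ μ = μ) {F : α → ℝ} (hF : MemLp F 2 μ) :
    MemLp (fun x => ∫ y, F y ∂(κ x)) 2 μ :=
  ⟨aestronglyMeasurable_integral_kernel hκ hF.1,
    (eLpNorm_integral_kernel_le hκ hF.1).trans_lt hF.2⟩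

/-- `F ↦ ∫ F dκ` as a map on `L²(μ)`. -/
noncomputable def kernelL2Fun (hκ : κ ∘ₘ μ = μ) (F : Lp ℝ 2 μ) : Lp ℝ 2 μ :=
  ((Lp.memLp F).integral_kernel hκ).toLp _

lemma kernelL2Fun_add [IsProbabilityMeasure μ] (hκ : κ ∘ₘ μ = μ) (F G : Lp ℝ 2 μ) :
    kernelL2Fun hκ (F + G) = kernelL2Fun hκ F + kernelL2Fun hκ G := by
  rw [kernelL2Fun, kernelL2Fun, kernelL2Fun, ← MemLp.toLp_add, MemLp.toLp_eq_toLp_iff]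
  refine (integral_kernel_congr_ae hκ (Lp.coeFn_add F G)).trans ?_
  have hF : Integrable F (κ ∘ₘ μ) := hκ.symm ▸ (Lp.memLp F).integrable (by norm_num)
  have hG : Integrable G (κ ∘ₘ μ) := hκ.symm ▸ (Lp.memLp G).integrable (by norm_num)
  have h1 := Measure.ae_integrable_of_integrable_comp hF
  have h2 := Measure.ae_integrable_of_integrable_comp hG
  filter_upwards [h1, h2] with x hx hx' using integral_add hx hx'

lemma kernelL2Fun_smul (hκ : κ ∘ₘ μ = μ) (c : ℝ) (F : Lp ℝ 2 μ) :
    kernelL2Fun hκ (c • F) = c • kernelL2Fun hκ F := by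
  rw [kernelL2Fun, kernelL2Fun, ← MemLp.toLp_const_smul, MemLp.toLp_eq_toLp_iff]
  refine (integral_kernel_congr_ae hκ (Lp.coeFn_smul c F)).trans ?_
  exact Eventually.of_forall fun x => integral_const_mul c F

lemma norm_kernelL2Fun_le (hκ : κ ∘ₘ μ = μ) (F : Lp ℝ 2 μ) : ‖kernelL2Fun hκ F‖ ≤ ‖F‖ := by
  rw [kernelL2Fun, Lp.norm_toLp, Lp.norm_def]
  exact ENNReal.toReal_mono (Lp.memLp F).2.ne (eLpNorm_integral_kernel_le hκ (Lp.memLp F).1)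

/-- The contraction of `L²(μ)` induced by a Markov kernel with invariant measure `μ`. -/
noncomputable def kernelL2 [IsProbabilityMeasure μ] (hκ : κ ∘ₘ μ = μ) : Lp ℝ 2 μ →L[ℝ] Lp ℝ 2 μ :=
  LinearMap.mkContinuous ⟨⟨kernelL2Fun hκ, kernelL2Fun_add hκ⟩, kernelL2Fun_smul hκ⟩ 1
    fun F => (norm_kernelL2Fun_le hκ F).trans_eq (one_mul _).symm

lemma norm_kernelL2_le [IsProbabilityMeasure μ] (hκ : κ ∘ₘ μ = μ) (F : Lp ℝ 2 μ) :
    ‖kernelL2 hκ F‖ ≤ ‖F‖ :=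
  norm_kernelL2Fun_le hκ F

lemma kernelL2_toLp [IsProbabilityMeasure μ] (hκ : κ ∘ₘ μ = μ) {F : α → ℝ} (hF : MemLp F 2 μ) :
    kernelL2 hκ (hF.toLp F) = (hF.integral_kernel hκ).toLp _ := by
  change kernelL2Fun hκ _ = _
  rw [kernelL2Fun, MemLp.toLp_eq_toLp_iff]
  exact integral_kernel_congr_ae hκ hF.coeFn_toLp

end KernelL2

/-! ### Extension of a Feller semigroup to `L²(μ)`. -/

namespace FellerSemigroup

variable {E : Type*} [TopologicalSpace E] [MeasurableSpace E] [LocallyCompactSpace E]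
  [PolishSpace E] [BorelSpace E]

omit [LocallyCompactSpace E] [PolishSpace E] in
lemma memLp_zeroAtInfty (μ : Measure E) [IsFiniteMeasure μ] (f : C₀(E, ℝ)) : MemLp f 2 μ :=
  MemLp.of_bound f.continuous.aestronglyMeasurable ‖f‖ (Eventually.of_forall f.norm_apply_le)

omit [LocallyCompactSpace E] [PolishSpace E] in
lemma norm_toLp_zeroAtInfty_le (μ : Measure E) [IsProbabilityMeasure μ] (f : C₀(E, ℝ)) :
    ‖(memLp_zeroAtInfty μ f).toLp f‖ ≤ ‖f‖ := by
  have := Lp.norm_le_of_ae_bound (f := (memLp_zeroAtInfty μ f).toLp f) (norm_nonneg f) (by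
    filter_upwards [(memLp_zeroAtInfty μ f).coeFn_toLp] with x hx
    rw [hx]
    exact f.norm_apply_le x)
  simpa [measureUnivNNReal] using this

/-- Lets the semigroup law and strong continuity pass from `C₀` to `L²`, the kernels acting there as
contractions. -/
lemma dense_zeroAtInfty (μ : Measure E) [IsProbabilityMeasure μ] :
    DenseRange fun f : C₀(E, ℝ) => (memLp_zeroAtInfty μ f).toLp f := by
  let := TopologicalSpace.upgradeIsCompletelyMetrizable E
  intro F
  rw [Metric.mem_closure_iff]
  intro ε hε
  obtain ⟨g, hg1, hg2, hg3, hg4⟩ := (Lp.memLp F).exists_hasCompactSupport_eLpNorm_sub_le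
    (by norm_num) (ε := ENNReal.ofReal (ε / 2)) (by simpa using hε)
  let g₀ : C₀(E, ℝ) := ((⟨⟨g, hg3⟩, hg1⟩ : CompactlySupportedContinuousMap E ℝ) : C₀(E, ℝ))
  refine ⟨_, ⟨g₀, rfl⟩, ?_⟩
  rw [dist_eq_norm]
  have h1 : F - (memLp_zeroAtInfty μ g₀).toLp g₀ =
      ((Lp.memLp F).sub (memLp_zeroAtInfty μ g₀)).toLp _ := by
    rw [MemLp.toLp_sub (Lp.memLp F), Lp.toLp_coeFn]
  rw [h1, Lp.norm_toLp]
  refine (ENNReal.toReal_mono ENNReal.ofReal_ne_top hg2).trans_lt ?_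
  rw [ENNReal.toReal_ofReal (by positivity)]
  linarith

/-- The extension of a Feller semigroup to `L²(μ)`, for an invariant probability measure `μ`. -/
noncomputable def semigroupL2 (S : FellerSemigroup E) (μ : Measure E) [IsProbabilityMeasure μ]
    (hμ : ∀ t, S.kernel t ∘ₘ μ = μ) : ContractionSemigroup (Lp ℝ 2 μ) := by
  have hC₀ : ∀ t (f : C₀(E, ℝ)), kernelL2 (hμ t) ((memLp_zeroAtInfty μ f).toLp f) =
      (memLp_zeroAtInfty μ (S.semigroup.toFun t f)).toLp _ := fun t f => by
    rw [kernelL2_toLp, MemLp.toLp_eq_toLp_iff]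
    exact Eventually.of_forall fun x => (S.semigroup_apply t f x).symm
  exact
  { toFun := fun t => kernelL2 (hμ t)
    zero_apply := fun F => by
      refine congr_fun ((dense_zeroAtInfty μ).equalizer (by fun_prop) continuous_id ?_) F
      funext f
      simp only [Function.comp, hC₀, S.semigroup.zero_apply, id]
    add_apply := fun s t F => by
      refine congr_fun ((dense_zeroAtInfty μ).equalizer (g := fun F => kernelL2 (hμ (s + t)) F)
        (h := fun F => kernelL2 (hμ s) (kernelL2 (hμ t) F)) (by fun_prop) (by fun_prop) ?_) F
      funext f
      simp only [Function.comp, hC₀, S.semigroup.add_apply]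
    norm_le := fun t => norm_kernelL2_le (hμ t)
    tendsto_zero := fun F => by
      rw [Metric.tendsto_nhds]
      intro ε hε
      obtain ⟨f, hf⟩ := (dense_zeroAtInfty μ).exists_dist_lt F (ε := ε / 3) (by positivity)
      filter_upwards [Metric.tendsto_nhds.1 (S.semigroup.tendsto_zero f) (ε / 3) (by positivity)]
        with t ht
      set f' := (memLp_zeroAtInfty μ f).toLp f
      have h1 : dist (kernelL2 (hμ t) F) (kernelL2 (hμ t) f') < ε / 3 := by
        rw [dist_eq_norm, ← map_sub]
        exact (norm_kernelL2_le _ _).trans_lt (by rwa [← dist_eq_norm])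
      have h2 : dist (kernelL2 (hμ t) f') f' < ε / 3 := by
        rw [hC₀, dist_eq_norm, ← MemLp.toLp_sub]
        refine lt_of_le_of_lt ?_ ht
        rw [dist_eq_norm]
        exact norm_toLp_zeroAtInfty_le μ (S.semigroup.toFun t f - f)
      rw [dist_comm] at hf
      have := dist_triangle4 (kernelL2 (hμ t) F) (kernelL2 (hμ t) f') f' F
      linarith }

omit [LocallyCompactSpace E] [PolishSpace E] [BorelSpace E] in
lemma memLp_op (S : FellerSemigroup E) (μ : Measure E) [IsProbabilityMeasure μ]
    (hμ : ∀ t, S.kernel t ∘ₘ μ = μ) (t : ℝ≥0) {F : E → ℝ} (hF : MemLp F 2 μ) :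
    MemLp (S.op t F) 2 μ :=
  hF.integral_kernel (hμ t)

lemma semigroupL2_toLp (S : FellerSemigroup E) (μ : Measure E) [IsProbabilityMeasure μ]
    (hμ : ∀ t, S.kernel t ∘ₘ μ = μ) (t : ℝ≥0) {F : E → ℝ} (hF : MemLp F 2 μ) :
    (S.semigroupL2 μ hμ).toFun t (hF.toLp F) =
      MemLp.toLp (S.op t F) (S.memLp_op μ hμ t hF) :=
  kernelL2_toLp (hμ t) hF

lemma hasL2Generator_iff (S : FellerSemigroup E) (μ : Measure E) [IsProbabilityMeasure μ]
    (hμ : ∀ t, S.kernel t ∘ₘ μ = μ) {F G : E → ℝ} (hF : MemLp F 2 μ) (hG : MemLp G 2 μ) :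
    S.HasL2Generator μ F G ↔ (S.semigroupL2 μ hμ).HasGenerator (hF.toLp F) (hG.toLp G) := by
  rw [ContractionSemigroup.hasGenerator_iff, HasL2Generator, and_iff_right hF, and_iff_right hG,
    tendsto_iff_edist_tendsto_0]
  refine tendsto_congr fun t => ?_
  rw [semigroupL2_toLp, ← MemLp.toLp_sub, ← MemLp.toLp_const_smul, Lp.edist_toLp_toLp]
  congr 1
  funext x
  simp [div_eq_inv_mul]

end FellerSemigroup

/-! ### Generators beyond `C₀`: cutoffs, maximum principle and Dynkin's formula. -/

namespace ContractionSemigroup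

lemma norm_resolvent_le {X : Type*} [NormedAddCommGroup X] [NormedSpace ℝ X]
    (T : ContractionSemigroup X) (x : X) : ‖T.resolvent x‖ ≤ ‖x‖ := by
  have h1 : IntegrableOn (fun t : ℝ => Real.exp (-t) * ‖x‖) (Set.Ioi 0) :=
    (integrableOn_exp_neg_Ioi 0).mul_const _
  refine (norm_integral_le_of_norm_le h1 (Eventually.of_forall fun t => ?_)).trans_eq ?_
  · rw [norm_smul, Real.norm_eq_abs, Real.abs_exp]
    exact mul_le_mul_of_nonneg_left (T.norm_orbit_le x t) (Real.exp_nonneg _)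
  · rw [integral_mul_const, integral_exp_neg_Ioi_zero, one_mul]

end ContractionSemigroup

namespace ZeroAtInftyContinuousMap

variable {Y : Type*} [TopologicalSpace Y]

/-- The product of a bounded continuous function and a function vanishing at infinity. -/
noncomputable def bcfMul (H : Y →ᵇ ℝ) (χ : C₀(Y, ℝ)) : C₀(Y, ℝ) where
  toFun x := H x * χ x
  continuous_toFun := H.continuous.mul χ.continuous
  zero_at_infty' := bdd_le_mul_tendsto_zero' ‖H‖
    (Eventually.of_forall fun x => H.norm_coe_le_norm x) χ.zero_at_infty'

@[simp] lemma bcfMul_apply (H : Y →ᵇ ℝ) (χ : C₀(Y, ℝ)) (x : Y) : bcfMul H χ x = H x * χ x := rfl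

lemma norm_bcfMul_le (H : Y →ᵇ ℝ) {χ : C₀(Y, ℝ)} (hχ : ‖χ‖ ≤ 1) : ‖bcfMul H χ‖ ≤ ‖H‖ :=
  norm_le_of_forall (norm_nonneg _) fun x => by
    rw [bcfMul_apply, norm_mul]
    exact (mul_le_of_le_one_right (norm_nonneg _) ((norm_apply_le χ x).trans hχ)).trans
      (H.norm_coe_le_norm x)

lemma norm_cutoff_le {χ : ℕ → C₀(Y, ℝ)} (h0 : ∀ k x, 0 ≤ χ k x) (h1 : ∀ k x, χ k x ≤ 1) (k : ℕ) :
    ‖χ k‖ ≤ 1 :=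
  norm_le_of_forall zero_le_one fun x => by
    rw [Real.norm_eq_abs, abs_of_nonneg (h0 k x)]
    exact h1 k x

/-- On a locally compact σ-compact space the constant `1` is a limit of functions
vanishing at infinity. -/
lemma exists_seq_eventually_eq_one [RegularSpace Y] [LocallyCompactSpace Y] [SigmaCompactSpace Y] :
    ∃ χ : ℕ → C₀(Y, ℝ), (∀ k x, 0 ≤ χ k x) ∧ (∀ k x, χ k x ≤ 1) ∧
      ∀ x, ∀ᶠ k in atTop, χ k x = 1 := by
  let K : CompactExhaustion Y := default
  have h := fun k => exists_continuous_one_zero_of_isCompact (K.isCompact k) isClosed_empty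
    (Set.disjoint_empty (K k))
  choose f hf1 _ hf3 hf4 using h
  refine ⟨fun k => ((⟨f k, hf3 k⟩ : CompactlySupportedContinuousMap Y ℝ) : C₀(Y, ℝ)),
    fun k x => (hf4 k x).1, fun k x => (hf4 k x).2, fun x => ?_⟩
  obtain ⟨n, hn⟩ := K.exists_mem x
  filter_upwards [eventually_ge_atTop n] with k hk
  exact hf1 k (K.subset hk hn)

end ZeroAtInftyContinuousMap

namespace FellerSemigroup

open ZeroAtInftyContinuousMap

variable {Y : Type*} [TopologicalSpace Y] [MeasurableSpace Y] [OpensMeasurableSpace Y]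
  (Q : FellerSemigroup Y)

/-- The maximum principle: a comparison of a bounded function `F`, for which `G` is the pointwise
derivative of `Q_t F` at `0`, with the resolvent of a truncation of `F - G`. -/
lemma le_of_pointwise_generator (F G : Y →ᵇ ℝ)
    (hFG : ∀ x, Tendsto (fun t : ℝ≥0 => (Q.op t F x - F x) / t) (𝓝[>] 0) (𝓝 (G x)))
    (χ : C₀(Y, ℝ)) (h1 : ∀ x, χ x ≤ 1) {c : ℝ} (hc : ‖F‖ < c)
    (hc' : ‖F - G‖ ≤ c) (x : Y) :
    F x - Q.semigroup.resolvent (bcfMul (F - G) χ) x ≤ c * (1 - Q.semigroup.resolvent χ x) := by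
  set T := Q.semigroup
  set h := bcfMul (F - G) χ
  -- If the claim fails at `x`, then `F + k` exceeds `c` there. Near infinity `F + k < c`, because
  -- `‖F‖ < c` and `k` vanishes at infinity, so a maximum point `z` exists.
  set k : C₀(Y, ℝ) := c • T.resolvent χ - T.resolvent h with hk
  have hgen : T.HasGenerator k (c • (T.resolvent χ - χ) - (T.resolvent h - h)) := by
    have := HasDerivWithinAt.sub ((T.hasGenerator_resolvent χ).smul c) (T.hasGenerator_resolvent h)
    refine this.congr_of_mem (fun s _ => ?_) Set.self_mem_Ici
    simp [ContractionSemigroup.orbit, hk]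
  by_contra! hx
  have hpos : c < F x + k x := by
    simp only [hk, ZeroAtInftyContinuousMap.sub_apply, ZeroAtInftyContinuousMap.smul_apply,
      smul_eq_mul]
    linarith
  obtain ⟨z, hz⟩ := (F.continuous.add k.continuous).exists_forall_ge' x (by
    have := (tendsto_order.1 k.zero_at_infty').2 (c - ‖F‖) (by linarith)
    filter_upwards [this] with y hy
    have h2 : F y ≤ ‖F‖ := (le_abs_self _).trans (F.norm_coe_le_norm y)
    have h3 : k y < c - ‖F‖ := hy
    change F y + k y ≤ F x + k x
    linarith)
  have hzpos : c < F z + k z := hpos.trans_le (hz x)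
  have hk' := (T.hasGenerator_iff _ _).1 hgen
  have hkz := ((evalCLM z).continuous.tendsto _).comp hk'
  -- At a maximum point the generator is nonpositive, as averaging against a probability kernel
  -- cannot increase the value.
  have hle : G z + evalCLM z (c • (T.resolvent χ - χ) - (T.resolvent h - h)) ≤ 0 := by
    refine le_of_tendsto ((hFG z).add hkz) ?_
    filter_upwards [self_mem_nhdsWithin] with t ht
    have ht : 0 < (t : ℝ) := ht
    simp only [Function.comp, evalCLM_apply, ZeroAtInftyContinuousMap.smul_apply,
      ZeroAtInftyContinuousMap.sub_apply, smul_eq_mul]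
    rw [← div_eq_inv_mul, ← add_div]
    refine div_nonpos_of_nonpos_of_nonneg ?_ ht.le
    have h2 : Q.op t F z + T.toFun t k z = ∫ y, (F y + k y) ∂(Q.kernel t z) := by
      rw [integral_add (F.integrable _) (k.integrable _), op, semigroup_apply]
    have h3 : ∫ y, (F y + k y) ∂(Q.kernel t z) ≤ ∫ y, (F z + k z) ∂(Q.kernel t z) :=
      integral_mono ((F.integrable _).add (k.integrable _)) (integrable_const _) hz
    rw [integral_const, probReal_univ, one_smul] at h3
    linarith
  -- Combined with `F z + k z > c`, `hle` would give the strict reverse of this inequality.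
  have h4 : (F z - G z) * (1 - χ z) ≤ c * (1 - χ z) := by
    refine mul_le_mul_of_nonneg_right ?_ (by linarith [h1 z])
    exact (le_abs_self _).trans (((F - G).norm_coe_le_norm z).trans hc')
  simp only [h, hk, evalCLM_apply, ZeroAtInftyContinuousMap.smul_apply,
      ZeroAtInftyContinuousMap.sub_apply, smul_eq_mul, bcfMul_apply,
      BoundedContinuousFunction.coe_sub, Pi.sub_apply] at hle hzpos
  linarith

lemma abs_sub_resolvent_le (F G : Y →ᵇ ℝ)
    (hFG : ∀ x, Tendsto (fun t : ℝ≥0 => (Q.op t F x - F x) / t) (𝓝[>] 0) (𝓝 (G x)))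
    (χ : C₀(Y, ℝ)) (h1 : ∀ x, χ x ≤ 1) {c : ℝ} (hc : ‖F‖ < c)
    (hc' : ‖F - G‖ ≤ c) (x : Y) :
    |F x - Q.semigroup.resolvent (bcfMul (F - G) χ) x| ≤
      c * (1 - Q.semigroup.resolvent χ x) := by
  rw [abs_le']
  refine ⟨Q.le_of_pointwise_generator F G hFG χ h1 hc hc' x, ?_⟩
  have h := Q.le_of_pointwise_generator (-F) (-G) (fun x => ?_) χ h1 (c := c) (by simpa)
    (by rwa [← neg_sub', norm_neg]) x
  · have h2 : bcfMul (-F - -G) χ = (-1 : ℝ) • bcfMul (F - G) χ := by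
      ext y
      simp
      ring
    have h3 : Q.semigroup.resolvent ((-1 : ℝ) • bcfMul (F - G) χ) =
        (-1 : ℝ) • Q.semigroup.resolvent (bcfMul (F - G) χ) := by
      simp only [ContractionSemigroup.resolvent, ContractionSemigroup.orbit, map_smul]
      rw [← integral_smul]
      congr 1
      funext t
      rw [smul_comm]
    rw [h2, h3] at h
    simp only [BoundedContinuousFunction.coe_neg, Pi.neg_apply,
      ZeroAtInftyContinuousMap.smul_apply, smul_eq_mul] at h
    linarith
  · convert (hFG x).neg using 2 with t
    · simp only [op, BoundedContinuousFunction.coe_neg, Pi.neg_apply, integral_neg]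
      ring
    · rfl

section Approximation

variable {χ : ℕ → C₀(Y, ℝ)}

lemma tendsto_semigroup_bcfMul (h0 : ∀ k x, 0 ≤ χ k x) (h1 : ∀ k x, χ k x ≤ 1)
    (hχ : ∀ x, ∀ᶠ k in atTop, χ k x = 1) (H : Y →ᵇ ℝ) (t : ℝ≥0) (x : Y) :
    Tendsto (fun k => Q.semigroup.toFun t (bcfMul H (χ k)) x) atTop (𝓝 (Q.op t H x)) := by
  simp only [semigroup_apply, op]
  refine tendsto_integral_of_dominated_convergence (fun _ => ‖H‖)
    (fun k => (bcfMul H (χ k)).continuous.measurable.aestronglyMeasurable) (integrable_const _)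
    (fun k => Eventually.of_forall fun y => ?_) (Eventually.of_forall fun y => ?_)
  · exact (norm_apply_le _ y).trans (norm_bcfMul_le H (norm_cutoff_le h0 h1 k))
  · refine tendsto_const_nhds.congr' ?_
    filter_upwards [hχ y] with k hk
    simp [hk]

lemma tendsto_semigroup_cutoff (h0 : ∀ k x, 0 ≤ χ k x) (h1 : ∀ k x, χ k x ≤ 1)
    (hχ : ∀ x, ∀ᶠ k in atTop, χ k x = 1) (t : ℝ≥0) (x : Y) :
    Tendsto (fun k => Q.semigroup.toFun t (χ k) x) atTop (𝓝 1) := by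
  have := Q.tendsto_semigroup_bcfMul h0 h1 hχ (BoundedContinuousFunction.const Y 1) t x
  have h2 : ∀ k, bcfMul (BoundedContinuousFunction.const Y 1) (χ k) = χ k := fun k => by
    ext y
    simp
  simpa [h2, op] using this

/-- Uses that the kernels have total mass one. It makes the error term `c * (1 - R χ_k)` of the
maximum principle vanish in the limit. -/
lemma tendsto_resolvent_cutoff (h0 : ∀ k x, 0 ≤ χ k x) (h1 : ∀ k x, χ k x ≤ 1)
    (hχ : ∀ x, ∀ᶠ k in atTop, χ k x = 1) (x : Y) :
    Tendsto (fun k => Q.semigroup.resolvent (χ k) x) atTop (𝓝 1) := by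
  have h2 : ∀ k, Q.semigroup.resolvent (χ k) x =
      ∫ t in Set.Ioi (0 : ℝ), Real.exp (-t) * Q.semigroup.orbit (χ k) t x := fun k => by
    rw [← evalCLM_apply, ContractionSemigroup.resolvent,
      ← ContinuousLinearMap.integral_comp_comm _ (Q.semigroup.integrableOn_resolvent _)]
    simp
  simp only [h2]
  rw [← integral_exp_neg_Ioi_zero]
  refine tendsto_integral_of_dominated_convergence (fun t => Real.exp (-t))
    (fun k => ?_) (integrableOn_exp_neg_Ioi 0)
    (fun k => Eventually.of_forall fun t => ?_) (Eventually.of_forall fun t => ?_)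
  · have := (evalCLM x).continuous.comp (Q.semigroup.continuous_orbit (χ k))
    simp only [Function.comp_def, evalCLM_apply] at this
    exact Continuous.aestronglyMeasurable (by fun_prop)
  · rw [norm_mul, Real.norm_eq_abs, Real.abs_exp]
    refine mul_le_of_le_one_right (Real.exp_nonneg _) ?_
    exact (norm_apply_le _ x).trans
      ((Q.semigroup.norm_orbit_le _ _).trans (norm_cutoff_le h0 h1 k))
  · have := (Q.tendsto_semigroup_cutoff h0 h1 hχ t.toNNReal x).const_mul (Real.exp (-t))
    simpa [ContractionSemigroup.orbit] using this

end Approximation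

variable [RegularSpace Y] [LocallyCompactSpace Y] [SigmaCompactSpace Y]

/-- Strong continuity is assumed only on `C₀`; for bounded continuous `H`, measurability in time is
enough for the integrals below. -/
lemma stronglyMeasurable_op (H : Y →ᵇ ℝ) (x : Y) :
    StronglyMeasurable fun t : ℝ => Q.op t.toNNReal H x := by
  obtain ⟨χ, h0, h1, hχ⟩ := exists_seq_eventually_eq_one (Y := Y)
  refine stronglyMeasurable_of_tendsto (f := fun (k : ℕ) (t : ℝ) =>
    Q.semigroup.orbit (bcfMul H (χ k)) t x) atTop (fun k => ?_) ?_
  · exact ((evalCLM x).continuous.comp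
      (Q.semigroup.continuous_orbit (bcfMul H (χ k)))).stronglyMeasurable
  · exact tendsto_pi_nhds.2 fun t => Q.tendsto_semigroup_bcfMul h0 h1 hχ H _ x

/-- Bounded continuous functions in the domain of the pointwise generator satisfy the resolvent
form of Dynkin's formula. -/
lemma op_eq_of_pointwise_generator (F G : Y →ᵇ ℝ)
    (hFG : ∀ x, Tendsto (fun t : ℝ≥0 => (Q.op t F x - F x) / t) (𝓝[>] 0) (𝓝 (G x)))
    (t : ℝ≥0) (x : Y) :
    Q.op t F x = Real.exp t *
      (F x - ∫ s in (0 : ℝ)..t, Real.exp (-s) * Q.op s.toNNReal (F - G : Y →ᵇ ℝ) x) := by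
  obtain ⟨χ, h0, h1, hχ⟩ := exists_seq_eventually_eq_one (Y := Y)
  obtain ⟨c, hc, hc'⟩ : ∃ c, ‖F‖ < c ∧ ‖F - G‖ ≤ c :=
    ⟨max (‖F‖ + 1) ‖F - G‖, lt_max_of_lt_left (by linarith), le_max_right _ _⟩
  set T := Q.semigroup
  set R : ℕ → C₀(Y, ℝ) := fun k => T.resolvent (bcfMul (F - G) (χ k))
  have hb : ∀ k y, |F y - R k y| ≤ c * (1 - T.resolvent (χ k) y) := fun k y =>
    Q.abs_sub_resolvent_le F G hFG (χ k) (h1 k) hc hc' y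
  have hV : ∀ y, Tendsto (fun k => c * (1 - T.resolvent (χ k) y)) atTop (𝓝 0) := fun y => by
    have := ((Q.tendsto_resolvent_cutoff h0 h1 hχ y).const_sub 1).const_mul c
    simpa using this
  -- `F` is the pointwise limit of the resolvents `R k`, with a bound allowing dominated
  -- convergence; the formula follows by computing the limit of `T_t (R k)` in two ways.
  have hR : Tendsto (fun k => R k x) atTop (𝓝 (F x)) := by
    rw [tendsto_iff_norm_sub_tendsto_zero]
    refine squeeze_zero (fun _ => norm_nonneg _) (fun k => ?_) (hV x)
    rw [norm_sub_rev]
    exact hb k x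
  have hl : Tendsto (fun k => T.toFun t (R k) x) atTop (𝓝 (Q.op t F x)) := by
    simp only [T, semigroup_apply, op]
    refine tendsto_integral_of_dominated_convergence (fun _ => ‖F‖ + c * 2)
      (fun k => (R k).continuous.measurable.aestronglyMeasurable) (integrable_const _)
      (fun k => Eventually.of_forall fun y => ?_) (Eventually.of_forall fun y => ?_)
    · have e1 := hb k y
      have e2 := F.norm_coe_le_norm y
      have e3 : |T.resolvent (χ k) y| ≤ 1 := (norm_apply_le _ y).trans
        ((T.norm_resolvent_le _).trans (norm_cutoff_le h0 h1 k))
      have e4 : c * (1 - T.resolvent (χ k) y) ≤ c * 2 :=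
        mul_le_mul_of_nonneg_left (by linarith [(abs_le.1 e3).1])
          ((norm_nonneg F).trans hc.le)
      rw [Real.norm_eq_abs] at e2 ⊢
      have e5 := abs_sub_abs_le_abs_sub (R k y) (F y)
      rw [abs_sub_comm] at e5
      linarith
    · rw [tendsto_iff_norm_sub_tendsto_zero]
      refine squeeze_zero (fun _ => norm_nonneg _) (fun k => ?_) (hV y)
      rw [norm_sub_rev]
      exact hb k y
  have hr : Tendsto (fun k => T.toFun t (R k) x) atTop (𝓝 (Real.exp t *
      (F x - ∫ s in (0 : ℝ)..t, Real.exp (-s) * Q.op s.toNNReal (F - G : Y →ᵇ ℝ) x))) := by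
    have e : ∀ k, T.toFun t (R k) x = Real.exp t * (R k x - ∫ s in (0 : ℝ)..t,
        Real.exp (-s) * T.orbit (bcfMul (F - G) (χ k)) s x) := fun k => by
      have e1 := T.orbit_resolvent (bcfMul (F - G) (χ k)) t.2
      have e2 : T.orbit (T.resolvent (bcfMul (F - G) (χ k))) t = T.toFun t (R k) :=
        T.orbit_coe _ t
      have hcont := T.continuous_orbit (bcfMul (F - G) (χ k))
      rw [← e2]
      change T.orbit _ (t.1) x = _
      rw [e1, ZeroAtInftyContinuousMap.smul_apply, ZeroAtInftyContinuousMap.sub_apply,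
        smul_eq_mul, ← evalCLM_apply x (∫ s in (0 : ℝ)..t.1, _),
        ← ContinuousLinearMap.intervalIntegral_comp_comm]
      · simp [R]
      · exact Continuous.intervalIntegrable (by fun_prop) _ _
    simp only [e]
    refine (hR.sub ?_).const_mul _
    refine intervalIntegral.tendsto_integral_filter_of_dominated_convergence
      (fun _ => ‖F - G‖) (Eventually.of_forall fun k => ?_)
      (Eventually.of_forall fun k => Eventually.of_forall fun s hs => ?_)
      intervalIntegrable_const (Eventually.of_forall fun s _ => ?_)
    · have := (evalCLM x).continuous.comp (T.continuous_orbit (bcfMul (F - G) (χ k)))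
      simp only [Function.comp_def, evalCLM_apply] at this
      exact Continuous.aestronglyMeasurable (by fun_prop)
    · rw [Set.uIoc_of_le (NNReal.coe_nonneg t)] at hs
      rw [norm_mul, Real.norm_eq_abs, Real.abs_exp]
      refine (mul_le_of_le_one_left (norm_nonneg _) (Real.exp_le_one_iff.2 ?_)).trans ?_
      · linarith [hs.1]
      · exact (norm_apply_le _ x).trans ((T.norm_orbit_le _ _).trans
          (norm_bcfMul_le _ (norm_cutoff_le h0 h1 k)))
    · exact (Q.tendsto_semigroup_bcfMul h0 h1 hχ (F - G) s.toNNReal x).const_mul _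
  exact tendsto_nhds_unique hl hr

end FellerSemigroup

/-! ### Factor maps between Feller semigroups. -/

lemma ZeroAtInftyContinuousMap.norm_integralCLM_le {E : Type*} [TopologicalSpace E]
    [MeasurableSpace E] [OpensMeasurableSpace E] (μ : Measure E)
    [IsProbabilityMeasure μ] (f : C₀(E, ℝ)) : ‖integralCLM μ f‖ ≤ ‖f‖ := by
  have := norm_integral_le_of_norm_le_const (μ := μ) (Eventually.of_forall f.norm_apply_le)
  simpa using this

namespace FellerSemigroup

open ZeroAtInftyContinuousMap

/-- If, on a core for the generator of `S`, the generator of `Q` acts on functions of `p` as the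
generator of `S`, then `p` maps the process of `Q` to the process of `S`. -/
theorem map_kernel_eq {E Y : Type*} [TopologicalSpace E] [MeasurableSpace E]
    [LocallyCompactSpace E] [PolishSpace E] [BorelSpace E]
    [TopologicalSpace Y] [MeasurableSpace Y] [OpensMeasurableSpace Y]
    [RegularSpace Y] [LocallyCompactSpace Y] [SigmaCompactSpace Y]
    (S : FellerSemigroup E) (Q : FellerSemigroup Y) {p : Y → E} (hp : Continuous p)
    {D : Set C₀(E, ℝ)} (hD : S.IsCore D)
    (hgen : ∀ f g : C₀(E, ℝ), f ∈ D → (f, g) ∈ S.generatorGraph → ∀ x,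
      Tendsto (fun t : ℝ≥0 => (Q.op t (fun y => f (p y)) x - f (p x)) / t) (𝓝[>] 0) (𝓝 (g (p x))))
    (t : ℝ≥0) (x : Y) : (Q.kernel t x).map p = S.kernel t (p x) := by
  have hprob : ∀ s, IsProbabilityMeasure ((Q.kernel s x).map p) := fun s =>
    Measure.isProbabilityMeasure_map hp.aemeasurable
  -- The law at time `s` of the image under `p` of the process started at `x`, as a functional on
  -- `C₀(E)`; it is to be identified with that of `S` started at `p x`.
  set ℓ : ℝ → C₀(E, ℝ) →L[ℝ] ℝ := fun s => integralCLM ((Q.kernel s.toNNReal x).map p) with hℓ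
  let lift : C₀(E, ℝ) → Y →ᵇ ℝ := fun f => f.toBCF.compContinuous ⟨p, hp⟩
  have hℓ_op : ∀ s f, ℓ s f = Q.op s.toNNReal (lift f) x := fun s f => by
    rw [hℓ, integralCLM_apply,
      integral_map hp.aemeasurable (f := f) f.continuous.stronglyMeasurable.aestronglyMeasurable]
    rfl
  have hℓ_le : ∀ s f, ‖ℓ s f‖ ≤ ‖f‖ := fun s f => norm_integralCLM_le _ f
  have hℓ0 : ∀ f, ℓ 0 f = f (p x) := fun f => by
    rw [hℓ_op, op, Real.toNNReal_zero, Q.kernel_zero, Kernel.id_apply]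
    exact integral_dirac' _ _ (lift f).continuous.stronglyMeasurable
  have hmeas : ∀ f, StronglyMeasurable fun s => ℓ s f := fun f => by
    simp only [hℓ_op]
    exact Q.stronglyMeasurable_op (lift f) x
  have hint : ∀ f a b, IntervalIntegrable (fun s => Real.exp (-s) * ℓ s f) volume a b := by
    intro f a b
    refine IntervalIntegrable.continuousOn_mul ?_ (by fun_prop)
    refine (intervalIntegrable_const (c := ‖f‖)).mono_fun'
      (hmeas f).aestronglyMeasurable (Eventually.of_forall fun s => hℓ_le s f)
  have dynkin : ∀ f g, (f, g) ∈ S.generatorGraph → ∀ s : ℝ≥0,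
      ℓ s f = Real.exp s * (f (p x) - ∫ r in (0 : ℝ)..s, Real.exp (-r) * ℓ r (f - g)) := by
    intro f g hfg s
    have hΦ : Continuous fun h : C₀(E, ℝ) => ∫ r in (0 : ℝ)..s, Real.exp (-r) * ℓ r h := by
      refine LipschitzWith.continuous (K := s) (LipschitzWith.of_dist_le_mul fun h h' => ?_)
      rw [dist_eq_norm, dist_eq_norm, ← intervalIntegral.integral_sub (hint _ _ _) (hint _ _ _)]
      have := intervalIntegral.norm_integral_le_of_norm_le_const (a := (0 : ℝ)) (b := s)
        (f := fun r => Real.exp (-r) * ℓ r h - Real.exp (-r) * ℓ r h') (C := ‖h - h'‖) ?_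
      · simpa [mul_comm] using this
      · intro r hr
        rw [Set.uIoc_of_le (NNReal.coe_nonneg s)] at hr
        rw [← mul_sub, ← map_sub, norm_mul, Real.norm_eq_abs, Real.abs_exp]
        refine (mul_le_of_le_one_left (norm_nonneg _) (Real.exp_le_one_iff.2 ?_)).trans
          (hℓ_le r _)
        linarith [hr.1]
    -- Dynkin's formula is a closed relation between `f` and its image `g`, so it extends from the
    -- core to the full graph of the generator.
    have hcl : IsClosed {q : C₀(E, ℝ) × C₀(E, ℝ) | ℓ s q.1 = Real.exp s *
        (q.1 (p x) - ∫ r in (0 : ℝ)..s, Real.exp (-r) * ℓ r (q.1 - q.2))} := by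
      refine isClosed_eq ((ℓ s).continuous.comp continuous_fst)
        (continuous_const.mul (Continuous.sub ?_ ?_))
      · exact (evalCLM (p x)).continuous.comp continuous_fst
      · exact hΦ.comp (continuous_fst.sub continuous_snd)
    refine closure_minimal ?_ hcl (hD.2 hfg)
    rintro ⟨f, g⟩ ⟨hfg, hf⟩
    have h1 := Q.op_eq_of_pointwise_generator (lift f) (lift g) (hgen f g hf hfg) s x
    have h2 : lift f - lift g = lift (f - g) := rfl
    rw [h2] at h1
    simp only [← hℓ_op] at h1
    change ℓ s f = _
    rw [hℓ_op, Real.toNNReal_coe, h1]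
    rfl
  -- On the domain, continuity is read off Dynkin's formula; in general `f` is approximated from the
  -- domain, uniformly in time since each `ℓ s` is a contraction.
  have hcont : ∀ f, Continuous fun s => ℓ s f := by
    intro f
    refine continuous_of_uniform_approx_of_continuous fun u hu => ?_
    obtain ⟨ε, hε, hεu⟩ := Metric.mem_uniformity_dist.1 hu
    obtain ⟨f', hf', g, hfg⟩ := Metric.dense_iff.1 S.semigroup.dense_domain f ε hε
    rw [← mem_generatorGraph_iff] at hfg
    refine ⟨fun s => ℓ s f', ?_, fun s => hεu ?_⟩
    · have h1 : (fun s => ℓ s f') = (fun s : ℝ => Real.exp s * (f' (p x) - ∫ r in (0 : ℝ)..s,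
          Real.exp (-r) * ℓ r (f' - g))) ∘ fun s : ℝ => (s.toNNReal : ℝ) := by
        funext s
        rw [Function.comp, ← dynkin f' g hfg]
        simp only [hℓ, Real.toNNReal_coe]
      rw [h1]
      refine Continuous.comp ?_ (by fun_prop)
      have := intervalIntegral.continuous_primitive (hint (f' - g)) 0
      fun_prop
    · rw [dist_eq_norm, ← map_sub]
      refine (hℓ_le s _).trans_lt ?_
      rw [← dist_eq_norm, dist_comm]
      exact hf'
  have hderiv : ∀ f g, S.semigroup.HasGenerator f g → ∀ s, 0 ≤ s →
      HasDerivWithinAt (fun r => ℓ r f) (ℓ s g) (Set.Ici s) s := by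
    intro f g hfg s hs
    rw [← mem_generatorGraph_iff] at hfg
    have hc : Continuous fun r => Real.exp (-r) * ℓ r (f - g) := by
      have := hcont (f - g)
      fun_prop
    have d := (Real.hasDerivAt_exp s).mul
      ((hc.integral_hasStrictDerivAt 0 s).hasDerivAt.const_sub (f (p x)))
    -- Differentiating Dynkin's formula gives `ℓ s f - ℓ s (f - g)`, that is, the forward equation.
    have hval : ℓ s g = Real.exp s * (f (p x) - ∫ r in (0 : ℝ)..s, Real.exp (-r) * ℓ r (f - g)) +
        Real.exp s * -(Real.exp (-s) * ℓ s (f - g)) := by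
      have h1 := dynkin f g hfg ⟨s, hs⟩
      change ℓ s f = Real.exp s * (f (p x) - ∫ r in (0 : ℝ)..s, Real.exp (-r) * ℓ r (f - g)) at h1
      rw [← h1, mul_neg, ← mul_assoc, ← Real.exp_add, add_neg_cancel, Real.exp_zero, map_sub]
      ring
    rw [hval]
    refine d.hasDerivWithinAt.congr_of_mem (fun r hr => ?_) Set.self_mem_Ici
    exact dynkin f g hfg ⟨r, hs.trans hr⟩
  have := hprob t
  refine measure_ext fun f => ?_
  have h := S.semigroup.eq_comp_of_hasDerivWithinAt ℓ hℓ_le hcont hderiv f (NNReal.coe_nonneg t)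
  rw [hℓ0, ContractionSemigroup.orbit_coe, semigroup_apply] at h
  rw [← h, hℓ, integralCLM_apply, Real.toNNReal_coe]

lemma op_comp_eq {E Y : Type*} [TopologicalSpace E] [MeasurableSpace E]
    [TopologicalSpace Y] [MeasurableSpace Y] {S : FellerSemigroup E} {Q : FellerSemigroup Y}
    {p : Y → E} (hp : Measurable p) {t : ℝ≥0}
    (h : ∀ x, (Q.kernel t x).map p = S.kernel t (p x)) {f : E → ℝ} (hf : StronglyMeasurable f)
    (x : Y) : Q.op t (fun y => f (p y)) x = S.op t f (p x) := by
  rw [op, op, ← h x, integral_map hp.aemeasurable hf.aestronglyMeasurable]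

/-- The image of an invariant measure under a factor map is invariant. -/
lemma IsInvariant.map {E Y : Type*} [TopologicalSpace E] [MeasurableSpace E]
    [LocallyCompactSpace E] [PolishSpace E] [BorelSpace E]
    [TopologicalSpace Y] [MeasurableSpace Y]
    [LocallyCompactSpace Y] [PolishSpace Y] [BorelSpace Y]
    {S : FellerSemigroup E} {Q : FellerSemigroup Y} {p : Y → E} (hp : Measurable p)
    (h : ∀ t x, (Q.kernel t x).map p = S.kernel t (p x)) {μ : Measure Y} (hμ : Q.IsInvariant μ) :
    S.IsInvariant (μ.map p) := by
  have := hμ.1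
  have : IsProbabilityMeasure (μ.map p) := Measure.isProbabilityMeasure_map hp.aemeasurable
  refine isInvariant_of_bind_eq fun t => ?_
  ext s hs
  have hm : Measurable fun x => S.kernel t x s := Kernel.measurable_coe _ hs
  rw [Measure.bind_apply hs (Kernel.aemeasurable _), lintegral_map hm hp]
  simp only [← h]
  conv_rhs => rw [← hμ.bind_eq t]
  rw [Measure.map_apply hp hs, Measure.bind_apply (hp hs) (Kernel.aemeasurable _)]
  simp only [Measure.map_apply hp hs]

end FellerSemigroup

/-! ### Centred functions and intertwining on `L²`. -/

/-- The restriction of a contraction semigroup to an invariant subspace. -/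
def ContractionSemigroup.restrict {X : Type*} [NormedAddCommGroup X] [NormedSpace ℝ X]
    (T : ContractionSemigroup X) (M : Submodule ℝ X) (hM : ∀ t, ∀ x ∈ M, T.toFun t x ∈ M) :
    ContractionSemigroup M where
  toFun t := ((T.toFun t).comp M.subtypeL).codRestrict M fun x => hM t x x.2
  zero_apply x := Subtype.ext (T.zero_apply x)
  add_apply s t x := Subtype.ext (T.add_apply s t x)
  norm_le t x := T.norm_le t x
  tendsto_zero x := tendsto_subtype_rng.2 (T.tendsto_zero x)

/-- The integral of a composition with a measure preserving map. -/
lemma MeasureTheory.MeasurePreserving.integral_comp_of_aestronglyMeasurable {α β : Type*}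
    [MeasurableSpace α] [MeasurableSpace β] {μ : Measure α} {ν : Measure β} {p : α → β}
    (hp : MeasurePreserving p μ ν) {f : β → ℝ} (hf : AEStronglyMeasurable f ν) :
    ∫ x, f (p x) ∂μ = ∫ y, f y ∂ν := by
  rw [← hp.map_eq, integral_map hp.aemeasurable (by rwa [hp.map_eq])]

section L2

variable {α : Type*} [MeasurableSpace α] {μ : Measure α}

lemma inner_toLp {F G : α → ℝ} (hF : MemLp F 2 μ) (hG : MemLp G 2 μ) :
    inner ℝ (hF.toLp F) (hG.toLp G) = ∫ x, F x * G x ∂μ := by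
  rw [L2.inner_def]
  refine integral_congr_ae ?_
  filter_upwards [hF.coeFn_toLp, hG.coeFn_toLp] with x h1 h2
  simp [h1, h2, mul_comm]

lemma eLpNorm_eq_ofReal_norm_toLp {F : α → ℝ} (hF : MemLp F 2 μ) :
    eLpNorm F 2 μ = ENNReal.ofReal ‖hF.toLp F‖ := by
  rw [Lp.norm_toLp, ENNReal.ofReal_toReal hF.2.ne]

/-- The functions of mean zero in `L²(μ)`. -/
noncomputable def centredL2 (μ : Measure α) [IsProbabilityMeasure μ] :
    Submodule ℝ (Lp ℝ 2 μ) :=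
  (ℝ ∙ indicatorConstLp 2 MeasurableSet.univ (measure_ne_top μ Set.univ) (1 : ℝ))ᗮ

lemma mem_centredL2_iff [IsProbabilityMeasure μ] (f : Lp ℝ 2 μ) :
    f ∈ centredL2 μ ↔ ∫ x, f x ∂μ = 0 := by
  rw [centredL2, Submodule.mem_orthogonal_singleton_iff_inner_right,
    L2.inner_indicatorConstLp_one, setIntegral_univ]

end L2

namespace FellerSemigroup

variable {E : Type*} [TopologicalSpace E] [MeasurableSpace E] [LocallyCompactSpace E]
  [PolishSpace E] [BorelSpace E]

omit [LocallyCompactSpace E] [PolishSpace E] [BorelSpace E] in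
lemma integral_op (S : FellerSemigroup E) (μ : Measure E) [IsProbabilityMeasure μ]
    (hμ : ∀ t, S.kernel t ∘ₘ μ = μ) (t : ℝ≥0) {F : E → ℝ} (hF : MemLp F 2 μ) :
    ∫ x, S.op t F x ∂μ = ∫ x, F x ∂μ := by
  have hint : Integrable F (S.kernel t ∘ₘ μ) := (hμ t).symm ▸ hF.integrable (by norm_num)
  conv_rhs => rw [← hμ t, integral_measure_comp hint]
  rfl

lemma semigroupL2_mem_centredL2 (S : FellerSemigroup E) (μ : Measure E) [IsProbabilityMeasure μ]
    (hμ : ∀ t, S.kernel t ∘ₘ μ = μ) (t : ℝ≥0) (f : Lp ℝ 2 μ) (hf : f ∈ centredL2 μ) :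
    (S.semigroupL2 μ hμ).toFun t f ∈ centredL2 μ := by
  rw [mem_centredL2_iff] at hf ⊢
  rw [← hf, ← S.integral_op μ hμ t (Lp.memLp f)]
  refine integral_congr_ae ?_
  conv_lhs => rw [← Lp.toLp_coeFn f (Lp.memLp f), semigroupL2_toLp]
  exact MemLp.coeFn_toLp _

/-- Composition with a measure preserving factor map intertwines the semigroups on `L²`. -/
lemma semigroupL2_compMeasurePreserving {Y : Type*} [TopologicalSpace Y] [MeasurableSpace Y]
    [LocallyCompactSpace Y] [PolishSpace Y] [BorelSpace Y]
    {S : FellerSemigroup E} {Q : FellerSemigroup Y} {μ : Measure E} {ν : Measure Y}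
    [IsProbabilityMeasure μ] [IsProbabilityMeasure ν] (hμ : ∀ t, S.kernel t ∘ₘ μ = μ)
    (hν : ∀ t, Q.kernel t ∘ₘ ν = ν) {p : Y → E} (hp : MeasurePreserving p ν μ)
    (h : ∀ t x, (Q.kernel t x).map p = S.kernel t (p x)) (t : ℝ≥0) (f : Lp ℝ 2 μ) :
    Lp.compMeasurePreserving p hp ((S.semigroupL2 μ hμ).toFun t f) =
      (Q.semigroupL2 ν hν).toFun t (Lp.compMeasurePreserving p hp f) := by
  -- A strongly measurable representative lets the change of variables hold at every starting point.
  obtain ⟨F, hF, hf⟩ : ∃ F : E → ℝ, ∃ hF : MemLp F 2 μ, StronglyMeasurable F ∧ f = hF.toLp F :=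
    ⟨f, Lp.memLp f, Lp.stronglyMeasurable f, (Lp.toLp_coeFn f _).symm⟩
  obtain ⟨hFm, rfl⟩ := hf
  rw [semigroupL2_toLp, Lp.toLp_compMeasurePreserving, Lp.toLp_compMeasurePreserving,
    semigroupL2_toLp, MemLp.toLp_eq_toLp_iff]
  exact Eventually.of_forall fun x => (op_comp_eq hp.measurable (h t) hFm x).symm

end FellerSemigroup

/-! ### The mean map from `L²(π)` to `L²(πbar)`. -/

section MeanL2

variable {E : Type*} [MeasurableSpace E] {n : ℕ} {π : Measure E} {πbar : Measure (Fin n → E)}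

/-- The map `f ↦ (1/n) ∑ i, f_i` from `L²(π)` to `L²(πbar)`. -/
noncomputable def meanL2
    (hmarg : ∀ i : Fin n, MeasurePreserving (fun x : Fin n → E => x i) πbar π) :
    Lp ℝ 2 π →L[ℝ] Lp ℝ 2 πbar :=
  (1 / (n : ℝ)) • ∑ i, (Lp.compMeasurePreservingₗᵢ ℝ _ (hmarg i)).toContinuousLinearMap

lemma meanL2_apply (hmarg : ∀ i : Fin n, MeasurePreserving (fun x : Fin n → E => x i) πbar π)
    (f : Lp ℝ 2 π) :
    meanL2 hmarg f = (1 / (n : ℝ)) • ∑ i, Lp.compMeasurePreserving _ (hmarg i) f := by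
  simp only [meanL2, smul_apply, sum_apply]
  rfl

lemma MeasureTheory.MemLp.toLp_finsetSum {α ι : Type*} [MeasurableSpace α] {μ : Measure α}
    {f : ι → α → ℝ} (s : Finset ι) (hf : ∀ i, MemLp (f i) 2 μ) :
    (memLp_finsetSum s fun i _ => hf i).toLp _ = ∑ i ∈ s, (hf i).toLp (f i) := by
  induction s using Finset.cons_induction with
  | empty =>
    simp only [Finset.sum_empty]
    exact MemLp.toLp_zero _
  | cons a s ha ih =>
    simp only [Finset.sum_cons]
    rw [← ih, ← MemLp.toLp_add]
    rfl

lemma memLp_mean (hmarg : ∀ i : Fin n, MeasurePreserving (fun x : Fin n → E => x i) πbar π)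
    {f : E → ℝ} (hf : MemLp f 2 π) :
    MemLp (fun x => (1 / (n : ℝ)) * ∑ i, coordFun f i x) 2 πbar :=
  (memLp_finsetSum Finset.univ fun i _ => hf.comp_measurePreserving (hmarg i)).const_mul _

lemma meanL2_toLp (hmarg : ∀ i : Fin n, MeasurePreserving (fun x : Fin n → E => x i) πbar π)
    {f : E → ℝ} (hf : MemLp f 2 π) :
    meanL2 hmarg (hf.toLp f) = (memLp_mean hmarg hf).toLp _ := by
  rw [meanL2_apply]
  simp only [Lp.toLp_compMeasurePreserving]
  rw [← MemLp.toLp_finsetSum, ← MemLp.toLp_const_smul]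
  rfl

variable [IsProbabilityMeasure π]

/-- Together with `isCentredMean_meanL2`, this identifies the admissible observables with the image
of `centredL2 π`, up to null sets. -/
lemma IsCentredMean.exists_toLp_eq
    (hmarg : ∀ i : Fin n, MeasurePreserving (fun x : Fin n → E => x i) πbar π)
    {F : (Fin n → E) → ℝ} (hF : IsCentredMean π πbar F) :
    ∃ f : centredL2 π, hF.1.toLp F = meanL2 hmarg f := by
  obtain ⟨hF', -, f, hf, hf0, hFf⟩ := hF
  refine ⟨⟨hf.toLp f, ?_⟩, ?_⟩
  · rw [mem_centredL2_iff, integral_congr_ae hf.coeFn_toLp, hf0]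
  · rw [meanL2_toLp, MemLp.toLp_eq_toLp_iff]
    exact hFf

/-- The mean is centred because every marginal of `πbar` is `π`. -/
lemma isCentredMean_meanL2
    (hmarg : ∀ i : Fin n, MeasurePreserving (fun x : Fin n → E => x i) πbar π)
    (f : centredL2 π) : IsCentredMean π πbar (meanL2 hmarg f) := by
  have hf := (mem_centredL2_iff _).1 f.2
  have hae : (meanL2 hmarg f : (Fin n → E) → ℝ) =ᵐ[πbar]
      fun x => (1 / (n : ℝ)) * ∑ i, coordFun (f : Lp ℝ 2 π) i x := by
    have h1 := meanL2_toLp hmarg (Lp.memLp (f : Lp ℝ 2 π))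
    rw [Lp.toLp_coeFn] at h1
    rw [h1]
    exact MemLp.coeFn_toLp _
  refine ⟨Lp.memLp _, ?_, (f : Lp ℝ 2 π), Lp.memLp _, hf, hae⟩
  have hint : Integrable (f : Lp ℝ 2 π) π := (Lp.memLp _).integrable (by norm_num)
  rw [integral_congr_ae hae, integral_const_mul, integral_finsetSum]
  · have : ∀ i : Fin n, ∫ x, coordFun (f : Lp ℝ 2 π) i x ∂πbar = 0 := fun i => by
      rw [← hf]
      exact (hmarg i).integral_comp_of_aestronglyMeasurable (Lp.memLp _).1
    simp [this]
  · exact fun i _ => (hmarg i).integrable_comp_of_integrable hint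

end MeanL2

/-! ### Coordinate processes of the coupling and the main theorem. -/

/-- Under a coupled semigroup every coordinate process is a copy of the one-particle process. -/
lemma IsCoupledSemigroup.map_kernel_eq {E : Type*} [TopologicalSpace E] [MeasurableSpace E]
    [LocallyCompactSpace E] [PolishSpace E] [BorelSpace E] {n : ℕ} {S : FellerSemigroup E}
    {D : Set C₀(E, ℝ)} (hD : S.IsCore D)
    {Γ : boundedMeasurable (Fin n → E) →ₗ.[ℝ] boundedMeasurable (Fin n → E)}
    (hΓ : Γ ∈ couplingOperators S D n) {Sbar : FellerSemigroup (Fin n → E)}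
    (hSbar : IsCoupledSemigroup S D Γ Sbar) (i : Fin n) (t : ℝ≥0) (x : Fin n → E) :
    (Sbar.kernel t x).map (fun y => y i) = S.kernel t (x i) := by
  refine S.map_kernel_eq Sbar (continuous_apply i) hD (fun f g hf hfg x => ?_) t x
  obtain ⟨u, hu, hΓu⟩ := hΓ.1 i f hf
  -- Convergence on a one-point compact set suffices, and `Γ f_i = 0` leaves only the one-particle
  -- generator.
  have h := (hSbar.2 i f g hf hfg u hu).2.2 {x} isCompact_singleton
  have h1 := h.tendsto_at (Set.mem_singleton x)
  simp only [hΓu, ZeroMemClass.coe_zero, Pi.zero_apply, add_zero] at h1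
  exact h1

theorem theorem6p1 {V H E : Type*} [NormedAddCommGroup V] [NormedSpace ℝ V]
    [TopologicalSpace H] (I : ModelWithCorners ℝ V H)
    [TopologicalSpace E] [ChartedSpace H E] [IsManifold I ∞ E]
    [LocallyCompactSpace E] [PolishSpace E] [MeasurableSpace E] [BorelSpace E]
    (n : ℕ) (hn : 1 ≤ n)
    -- the one-particle dynamics and its invariant measure
    (S : FellerSemigroup E) (hcore : S.IsCore (testFunctions I E))
    (π : Measure E) (hπ : S.IsErgodic π)
    -- an ergodic coupling operator, with its semigroup and invariant measure
    (Γ : boundedMeasurable (Fin n → E) →ₗ.[ℝ] boundedMeasurable (Fin n → E))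
    (hΓ : Γ ∈ couplingOperators S (testFunctions I E) n)
    (Sbar : FellerSemigroup (Fin n → E))
    (hSbar : IsCoupledSemigroup S (testFunctions I E) Γ Sbar)
    (πbar : Measure (Fin n → E)) (hπbar : Sbar.IsErgodic πbar)
    (Λ : ℝ) (hΛ : 0 < Λ) :
    (∀ F G : (Fin n → E) → ℝ, IsCentredMean π πbar F → Sbar.HasL2Generator πbar F G →
        ∫ x, F x * F x ∂πbar ≤ 1 / Λ * ∫ x, F x * (-G x) ∂πbar) ↔
      (∀ F : (Fin n → E) → ℝ, IsCentredMean π πbar F → ∀ t : ℝ≥0,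
        eLpNorm (Sbar.op t F) 2 πbar ^ 2 ≤
          ENNReal.ofReal (Real.exp (-2 * Λ * t)) * eLpNorm F 2 πbar ^ 2) := by
  have hker := hSbar.map_kernel_eq hcore hΓ
  have hproj : ∀ i : Fin n, Measurable fun x : Fin n → E => x i := measurable_pi_apply
  -- The `i`-th marginal of `πbar` is invariant for `S`; uniqueness of the invariant measure
  -- identifies it with `π`.
  have hmarg : ∀ i : Fin n, MeasurePreserving (fun x : Fin n → E => x i) πbar π := fun i =>
    ⟨hproj i, hπ.2.1 _ (hπbar.1.map (hproj i) (hker i))⟩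
  have := hπ.1.1
  have := hπbar.1.1
  let T := (S.semigroupL2 π hπ.1.bind_eq).restrict (centredL2 π)
    (S.semigroupL2_mem_centredL2 π hπ.1.bind_eq)
  let U := Sbar.semigroupL2 πbar hπbar.1.bind_eq
  let J : centredL2 π →L[ℝ] Lp ℝ 2 πbar := (meanL2 hmarg).comp (centredL2 π).subtypeL
  have hJ : ∀ t f, J (T.toFun t f) = U.toFun t (J f) := by
    intro t f
    change meanL2 hmarg ((S.semigroupL2 π hπ.1.bind_eq).toFun t f) = U.toFun t (meanL2 hmarg f)
    simp only [meanL2_apply, map_smul, map_sum]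
    congr 1
    exact Finset.sum_congr rfl fun i _ => FellerSemigroup.semigroupL2_compMeasurePreserving
      hπ.1.bind_eq hπbar.1.bind_eq (hmarg i) (hker i) t f
  -- Defined as an orthogonal complement, this space is closed; completeness is needed for averaging
  -- orbits of `T`.
  have : CompleteSpace (centredL2 π) := by
    unfold centredL2
    infer_instance
  refine Iff.trans ?_ ((T.coercive_iff_decay U J hJ hΛ).trans ?_)
  · constructor
    · intro h f G hG
      have hF := isCentredMean_meanL2 hmarg f
      have hG' : Sbar.HasL2Generator πbar (meanL2 hmarg f) G := by
        rw [Sbar.hasL2Generator_iff πbar hπbar.1.bind_eq hF.1 (Lp.memLp G), Lp.toLp_coeFn,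
          Lp.toLp_coeFn]
        exact hG
      have h1 := h _ _ hF hG'
      have h2 := inner_toLp hF.1 hF.1
      have h3 := inner_toLp hF.1 (Lp.memLp G).neg
      rw [MemLp.toLp_neg (Lp.memLp G), Lp.toLp_coeFn, Lp.toLp_coeFn] at h3
      rw [Lp.toLp_coeFn, real_inner_self_eq_norm_sq] at h2
      simp only [Pi.neg_apply] at h3
      rw [← h2, ← h3] at h1
      exact h1
    · intro h F G hF hFG
      obtain ⟨f, hf⟩ := hF.exists_toLp_eq hmarg
      have hG := (Sbar.hasL2Generator_iff πbar hπbar.1.bind_eq hF.1 hFG.2.1).1 hFG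
      rw [hf] at hG
      have h1 := h f _ hG
      change ‖meanL2 hmarg f‖ ^ 2 ≤ 1 / Λ * inner ℝ (meanL2 hmarg f) _ at h1
      rw [← hf, ← real_inner_self_eq_norm_sq, ← MemLp.toLp_neg, inner_toLp,
        inner_toLp] at h1
      exact h1
  · have key : ∀ (F : (Fin n → E) → ℝ) (hF : MemLp F 2 πbar) (t : ℝ≥0),
        eLpNorm (Sbar.op t F) 2 πbar ^ 2 ≤
          ENNReal.ofReal (Real.exp (-2 * Λ * t)) * eLpNorm F 2 πbar ^ 2 ↔
        ‖U.toFun t (hF.toLp F)‖ ^ 2 ≤ Real.exp (-2 * Λ * t) * ‖hF.toLp F‖ ^ 2 := by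
      intro F hF t
      rw [eLpNorm_eq_ofReal_norm_toLp hF,
        eLpNorm_eq_ofReal_norm_toLp (Sbar.memLp_op πbar hπbar.1.bind_eq t hF),
        ← ENNReal.ofReal_pow (norm_nonneg _), ← ENNReal.ofReal_pow (norm_nonneg _),
        ← ENNReal.ofReal_mul (Real.exp_nonneg _), ENNReal.ofReal_le_ofReal_iff (by positivity),
        FellerSemigroup.semigroupL2_toLp]
    constructor
    · intro h F hF t
      obtain ⟨f, hf⟩ := hF.exists_toLp_eq hmarg
      rw [key F hF.1, hf]
      exact h f t
    · intro h f t
      have hF := isCentredMean_meanL2 hmarg f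
      have h1 := (key _ hF.1 t).1 (h _ hF t)
      rwa [Lp.toLp_coeFn] at h1
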